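/- Let $\mathbb{K}$ be an infinite field, $R=\mathbb{K}[s,t]$ and $S=\mathbb{K}[s,t,u]$ with its standard grading. Let $a_1,a_2,a_3,a_4\in R$ satisfy $\gcd(a_1,a_2,a_3,a_4)=1$, put $d=\max_i\deg(a_i)$, and assume $d\ge 1$. Let $b_i(s,t,u)=u^d\,a_i(s/u,t/u)\in S$ and let $\hat I=(b_1,b_2,b_3,b_4)\subset S$ be the homogenized ideal. Consider any graded free resolution $$0\longrightarrow \bigoplus_{i=1}^{a}S(-p_i)\xrightarrow{\ \hat d_2\ }\bigoplus_{i=1}^{a+3}S(-q_i)\xrightarrow{\ \hat d_1\ }S(-d)^4\xrightarrow{[b_1,b_2,b_3,b_4]}\hat I\longrightarrow 0$$ in which the images under $\hat d_1$ of the $a+3$ basis elements form a minimal system of homogeneous generators of the syzygy module $\mathrm{Syz}(b_1,b_2,b_3,b_4)$ (the generators $b_1,\dots,b_4$ of $\hat I$ themselves need not be minimal). Then \begin{enumerate} \item[(i)] $q_i\le 3d-1$ for all $1\le i\le a+3$; \item[(ii)] $p_i\le 3d$ for all $1\le i\le a$; \item[(iii)] $a=\beta_2(\hat I)$, where $\beta_2(\hat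 I)$ is the rank of the second module $F_2$ in the minimal graded free resolution $\cdots\to F_2\to F_1\to F_0\to\hat I\to 0$ of $\hat I$. \end{enumerate} -/

import Mathlib

namespace GradedRes

/-- `f` is homogeneous of the integer degree `n` (so `f = 0` when `n < 0`). These are the degree-zero
graded maps `S(-(n + e)) → S(-e)`, for every integer `e`. -/
def IsHomogeneousOfDegree {σ K : Type*} [CommSemiring K] (f : MvPolynomial σ K) (n : ℤ) : Prop :=
  ∀ c : σ →₀ ℕ, MvPolynomial.coeff c f ≠ 0 → ((c.degree : ℕ) : ℤ) = n

/-- The degree-`d` homogenization `u ^ d * f (s / u, t / u)` of `f ∈ K[s, t]`, for `deg f ≤ d`.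
The variables `s, t, u` are `X 0, X 1, X 2`. -/
noncomputable def homogenize {K : Type*} [CommSemiring K] (d : ℕ)
    (f : MvPolynomial (Fin 2) K) : MvPolynomial (Fin 3) K :=
  ∑ c ∈ f.support, MvPolynomial.C (MvPolynomial.coeff c f) *
    (MvPolynomial.X 0 ^ c 0 * MvPolynomial.X 1 ^ c 1 * MvPolynomial.X 2 ^ (d - (c 0 + c 1)))

/-- A graded free resolution
`⋯ → F 2 → F 1 → F 0 → I → 0`, `F i = ⨁ j, S(-twist i j)`, of an ideal `I` of a polynomial ring
`S` over a field, which is minimal: the image of each `F (i + 1) → F i` lies in `𝔪 F i`, where `𝔪`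
is the ideal generated by the variables. The maps are given by their matrices. -/
structure MinimalGradedFreeResolution {σ K : Type*} [Field K]
    (I : Ideal (MvPolynomial σ K)) where
  /-- the rank of `F i` -/
  rank : ℕ → ℕ
  /-- the degrees of the basis elements of `F i` -/
  twist : (i : ℕ) → Fin (rank i) → ℤ
  /-- the images in `I` of the basis elements of `F 0` -/
  gen : Fin (rank 0) → MvPolynomial σ K
  /-- the matrix of `F (i + 1) → F i` -/
  diff : (i : ℕ) → Matrix (Fin (rank i)) (Fin (rank (i + 1))) (MvPolynomial σ K)
  gen_homogeneous : ∀ j, IsHomogeneousOfDegree (gen j) (twist 0 j)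
  diff_homogeneous : ∀ i j k, IsHomogeneousOfDegree (diff i j k) (twist (i + 1) k - twist i j)
  span_gen : Ideal.span (Set.range gen) = I
  exact_zero : Function.Exact (diff 0).mulVecLin
    (Fintype.linearCombination (MvPolynomial σ K) gen)
  exact_succ : ∀ i, Function.Exact (diff (i + 1)).mulVecLin (diff i).mulVecLin
  minimal : ∀ i j k, diff i j k ∈
    Ideal.span (Set.range (MvPolynomial.X : σ → MvPolynomial σ K))

/-- The Betti number `β_i(I)` of a homogeneous ideal `I`: the rank of the `i`-th module in a
minimal graded free resolution of `I`. All of them have the same ranks, so that the infimum is over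
a one-element set. -/
noncomputable def bettiNumber {σ K : Type*} [Field K] (I : Ideal (MvPolynomial σ K)) (i : ℕ) : ℕ :=
  sInf {n | ∃ F : MinimalGradedFreeResolution I, F.rank i = n}

/-- The matrices `D₁`, `D₂` define a graded free resolution
`0 → ⨁ i, S(-p i) → ⨁ i, S(-q i) → S(-d)⁴ → (b 0, b 1, b 2, b 3) → 0`
whose last map is the row `[b 0, b 1, b 2, b 3]`, and in which the columns of `D₁` are
a minimal system of generators of the syzygy module of `b 0, b 1, b 2, b 3`: none of them lies in
the submodule generated by the others. Nothing is asked of the generators `b 0, b 1, b 2, b 3`. -/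
structure IsResolution {K : Type*} [Field K] (b : Fin 4 → MvPolynomial (Fin 3) K) (d : ℕ)
    {a : ℕ} (p : Fin a → ℤ) (q : Fin (a + 3) → ℤ)
    (D₁ : Matrix (Fin 4) (Fin (a + 3)) (MvPolynomial (Fin 3) K))
    (D₂ : Matrix (Fin (a + 3)) (Fin a) (MvPolynomial (Fin 3) K)) : Prop where
  homogeneous₁ : ∀ j i, IsHomogeneousOfDegree (D₁ j i) (q i - d)
  homogeneous₂ : ∀ i k, IsHomogeneousOfDegree (D₂ i k) (p k - q i)
  exact₀ : Function.Exact D₁.mulVecLin (Fintype.linearCombination (MvPolynomial (Fin 3) K) b)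
  exact₁ : Function.Exact D₂.mulVecLin D₁.mulVecLin
  injective : Function.Injective D₂.mulVecLin
  minimal : ∀ i, D₁.col i ∉ Submodule.span (MvPolynomial (Fin 3) K) (D₁.col '' {i}ᶜ)

end GradedRes

/-!
Write `S = K[s, t, u]` and let `I` be the ideal of the four forms `b i` of degree `d`. They have no
common factor, so that `I` defines finitely many points of the projective plane, and since `K`
is infinite there is a line `l = 0`, with `l = u - α s - β t`, that misses them
(`exists_slice_no_common_prime`, by Krull's height theorem and prime avoidance). On the line, two
general elements `F`, `G` of the linear system of the `b i` are coprime
(`exists_isRelPrime_linear_combination`). Coprime binary forms of degree `d` generate all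
forms of degree at least `2 d - 1` (`exists_eq_mul_add_mul_of_isRelPrime`), and `F`, `G`, `l` is a
regular sequence. Both bounds follow from these two facts.

* A syzygy of the `b i` with entries of degree at least `2 d` is, modulo `l`, a combination with
  coefficients in the maximal ideal `𝔪` of Koszul syzygies that involve `F` or `G`. Hence it lies in
  `𝔪 Syz`, and it is not a minimal generator (`GeneralLine.exists_syzygy_eq_sum_X_mul`). These
  are the syzygies of degree at least `3 d`.
* If `l h ∈ I` and `deg h ≥ 3 d - 2`, then `h ∈ I`
  (`GeneralLine.exists_eq_sum_of_linForm_mul_eq`). With this, a relation of degree at least `3 d + 1`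
  between the generators of `Syz` can be divided modulo `l` in two variables, and it lies in `𝔪`
  times the module of relations (`GeneralLine.exists_mem_ker_eq_sum_X_mul`).

For the Betti number, a minimal resolution is built by iterating minimal generators of syzygy
modules (`nonempty_minimalGradedFreeResolution`). In the given resolution the matrix `D₂` has its
entries in `𝔪`, because the columns of `D₁` are minimal generators. The chain maps between the
two resolutions that lift the identity of `I` are therefore inverse to each other modulo `𝔪` on
the second modules, whose ranks thus agree (`card_le_of_exact`); the minimality of the
generators `b i` themselves plays no role in this.
-/

namespace GradedRes

open MvPolynomial

/-! ### Homogeneous components of integer degree -/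

section Components

variable {σ K : Type*} [Field K]

/-- The homogeneous component of integer degree `n`; it vanishes for `n < 0`. -/
noncomputable def gcomp (n : ℤ) : MvPolynomial σ K →ₗ[K] MvPolynomial σ K :=
  if 0 ≤ n then homogeneousComponent n.toNat else 0

theorem coeff_gcomp (n : ℤ) (f : MvPolynomial σ K) (c : σ →₀ ℕ) :
    coeff c (gcomp n f) = if ((c.degree : ℕ) : ℤ) = n then coeff c f else 0 := by
  classical
  unfold gcomp
  by_cases hn : 0 ≤ n
  · rw [if_pos hn, coeff_homogeneousComponent]
    congr 1
    simp only [eq_iff_iff]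
    omega
  · rw [if_neg hn, if_neg (by omega)]
    simp

theorem isHomogeneousOfDegree_gcomp (n : ℤ) (f : MvPolynomial σ K) :
    IsHomogeneousOfDegree (gcomp n f) n := by
  intro c hc
  rw [coeff_gcomp] at hc
  by_contra h
  exact hc (if_neg h)

theorem isHomogeneousOfDegree_zero (n : ℤ) :
    IsHomogeneousOfDegree (0 : MvPolynomial σ K) n := by
  intro c hc
  simp at hc

theorem isHomogeneousOfDegree_C (r : K) :
    IsHomogeneousOfDegree (C r : MvPolynomial σ K) 0 := by
  classical
  intro c hc
  rw [coeff_C] at hc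
  split_ifs at hc with h
  · simp [← h]
  · exact absurd rfl hc

theorem isHomogeneousOfDegree_natCast {f : MvPolynomial σ K} {n : ℕ} :
    IsHomogeneousOfDegree f (n : ℤ) ↔ f.IsHomogeneous n := by
  constructor
  · intro h c hc
    have := h c hc
    rw [Finsupp.degree_eq_weight_one] at this
    exact_mod_cast this
  · intro h c hc
    have := h hc
    rw [Finsupp.degree_eq_weight_one]
    exact_mod_cast this

theorem isHomogeneousOfDegree_X (i : σ) :
    IsHomogeneousOfDegree (X i : MvPolynomial σ K) 1 :=
  isHomogeneousOfDegree_natCast (n := 1).2 (isHomogeneous_X K i)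

namespace IsHomogeneousOfDegree

variable {f g : MvPolynomial σ K} {m n : ℤ}

theorem gcomp_eq (hf : IsHomogeneousOfDegree f n) : gcomp n f = f := by
  ext c
  rw [coeff_gcomp]
  split_ifs with h
  · rfl
  · by_contra h'
    exact h (hf c (Ne.symm h'))

theorem gcomp_of_ne (hf : IsHomogeneousOfDegree f n) (h : m ≠ n) : gcomp m f = 0 := by
  ext c
  rw [coeff_gcomp, coeff_zero]
  split_ifs with h1
  · by_contra h'
    exact h (h1.symm.trans (hf c h'))
  · rfl

theorem gcomp_mul (hf : IsHomogeneousOfDegree f m) (n : ℤ) (g : MvPolynomial σ K) :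
    gcomp n (f * g) = f * gcomp (n - m) g := by
  classical
  ext c
  rw [coeff_gcomp, coeff_mul, coeff_mul]
  rw [← Finset.sum_const_zero (s := Finset.HasAntidiagonal.antidiagonal c),
    ← Finset.sum_ite_irrel]
  refine Finset.sum_congr rfl fun x hx => ?_
  by_cases h0 : coeff x.1 f = 0
  · simp [h0]
  have h1 := hf _ h0
  have h2 : (x.1.degree + x.2.degree : ℕ) = c.degree := by
    rw [← map_add, Finset.HasAntidiagonal.mem_antidiagonal.1 hx]
  rw [coeff_gcomp, mul_ite, mul_zero]
  congr 1
  simp only [eq_iff_iff]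
  omega

theorem add (hf : IsHomogeneousOfDegree f n) (hg : IsHomogeneousOfDegree g n) :
    IsHomogeneousOfDegree (f + g) n := by
  rw [← hf.gcomp_eq, ← hg.gcomp_eq, ← map_add]
  exact isHomogeneousOfDegree_gcomp _ _

theorem neg (hf : IsHomogeneousOfDegree f n) : IsHomogeneousOfDegree (-f) n := by
  rw [← hf.gcomp_eq, ← map_neg]
  exact isHomogeneousOfDegree_gcomp _ _

theorem sub (hf : IsHomogeneousOfDegree f n) (hg : IsHomogeneousOfDegree g n) :
    IsHomogeneousOfDegree (f - g) n := by
  rw [sub_eq_add_neg]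
  exact hf.add hg.neg

theorem sum {ι : Type*} {s : Finset ι} {f : ι → MvPolynomial σ K}
    (hf : ∀ i ∈ s, IsHomogeneousOfDegree (f i) n) :
    IsHomogeneousOfDegree (∑ i ∈ s, f i) n :=
  Finset.sum_induction _ (IsHomogeneousOfDegree · n) (fun _ _ => add)
    (isHomogeneousOfDegree_zero n) hf

theorem mul (hf : IsHomogeneousOfDegree f m) (hg : IsHomogeneousOfDegree g n) :
    IsHomogeneousOfDegree (f * g) (m + n) := by
  rw [← hg.gcomp_eq, show n = (m + n) - m by ring, ← hf.gcomp_mul]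
  ring_nf
  exact isHomogeneousOfDegree_gcomp _ _

theorem congr (hf : IsHomogeneousOfDegree f m) (h : m = n) : IsHomogeneousOfDegree f n := h ▸ hf

theorem eq_zero_of_neg (hf : IsHomogeneousOfDegree f n) (h : n < 0) : f = 0 := by
  ext c
  by_contra h'
  have := hf c h'
  omega

theorem eq_C (hf : IsHomogeneousOfDegree f n) (h : constantCoeff f ≠ 0) :
    f = C (constantCoeff f) := by
  classical
  ext c
  rw [coeff_C]
  split_ifs with h0
  · rw [← h0]; rfl
  · by_contra h'
    have h1 := hf c h'
    have h2 := hf 0 h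
    simp only [map_zero] at h2
    rw [← h2] at h1
    have : c.degree = 0 := by exact_mod_cast h1
    rw [Finsupp.degree_eq_zero_iff] at this
    exact h0 this.symm

theorem constantCoeff_eq_zero (hf : IsHomogeneousOfDegree f n) (h : n ≠ 0) :
    constantCoeff f = 0 := by
  by_contra h'
  have := hf 0 h'
  simp at this
  exact h this.symm

/-- If a nonzero form divides a form of a different degree, the quotient has no constant term. -/
theorem constantCoeff_eq_zero_of_mul (hf : IsHomogeneousOfDegree f m) (h0 : f ≠ 0)
    (hfg : IsHomogeneousOfDegree (f * g) n) (h : n ≠ m) : constantCoeff g = 0 := by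
  have h1 := hfg.gcomp_of_ne h.symm
  rw [hf.gcomp_mul, sub_self, mul_eq_zero, or_iff_right h0] at h1
  have := coeff_gcomp 0 g 0
  rw [h1] at this
  exact (by simpa using this.symm : coeff 0 g = 0)

/-- The quotient of two forms is a form. -/
theorem of_mul (hf : IsHomogeneousOfDegree f m) (h0 : f ≠ 0)
    (hfg : IsHomogeneousOfDegree (f * g) n) : IsHomogeneousOfDegree g (n - m) := by
  have h1 := hfg.gcomp_eq
  rw [hf.gcomp_mul] at h1
  rw [← mul_left_cancel₀ h0 h1]
  exact isHomogeneousOfDegree_gcomp _ _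

end IsHomogeneousOfDegree

theorem exists_eq_sum_X_mul [Fintype σ] {f : MvPolynomial σ K} (h : constantCoeff f = 0) :
    ∃ g : σ → MvPolynomial σ K, f = ∑ j, X j * g j := by
  have : f ∈ Ideal.span (X '' (Set.univ : Set σ)) := by
    rw [mem_ideal_span_X_image]
    intro m hm
    by_contra! h'
    have : m = 0 := by ext i; exact h' i trivial
    subst this
    exact (mem_support_iff.1 hm) h
  rw [Set.image_univ, Ideal.mem_span_range_iff_exists_fun] at this
  obtain ⟨c, hc⟩ := this
  exact ⟨c, by rw [← hc]; exact Finset.sum_congr rfl fun i _ => mul_comm _ _⟩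

theorem IsHomogeneousOfDegree.exists_eq_sum_X_mul [Fintype σ] {f : MvPolynomial σ K} {n : ℤ}
    (hf : IsHomogeneousOfDegree f n) (h : constantCoeff f = 0) :
    ∃ g : σ → MvPolynomial σ K, (∀ j, IsHomogeneousOfDegree (g j) (n - 1)) ∧
      f = ∑ j, X j * g j := by
  obtain ⟨g, hg⟩ := GradedRes.exists_eq_sum_X_mul h
  refine ⟨fun j => gcomp (n - 1) (g j), fun j => isHomogeneousOfDegree_gcomp _ _, ?_⟩
  conv_lhs => rw [← hf.gcomp_eq, hg, map_sum]
  exact Finset.sum_congr rfl fun j _ => (isHomogeneousOfDegree_X j).gcomp_mul n (g j)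

theorem constantCoeff_of_mem_span_X {f : MvPolynomial σ K}
    (h : f ∈ Ideal.span (Set.range (X : σ → MvPolynomial σ K))) : constantCoeff f = 0 := by
  have : Ideal.span (Set.range (X : σ → MvPolynomial σ K)) ≤ RingHom.ker constantCoeff := by
    rw [Ideal.span_le]
    rintro _ ⟨i, rfl⟩
    simp
  exact this h

end Components

/-! ### Coprime binary forms -/

section BinaryForms

variable {K : Type*} [Field K]

theorem finrank_homogeneousSubmodule_fin_two (k : ℕ) :
    Module.finrank K (homogeneousSubmodule (Fin 2) K k) = k + 1 ∧
      FiniteDimensional K (homogeneousSubmodule (Fin 2) K k) := by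
  classical
  let e0 : {c : Fin 2 →₀ ℕ // c.degree = k} ≃ Finset.HasAntidiagonal.antidiagonal k :=
    ((Finsupp.equivFunOnFinite : (Fin 2 →₀ ℕ) ≃ (Fin 2 → ℕ)).trans (finTwoArrowEquiv ℕ)).subtypeEquiv
      (by
        intro c
        simp [Finsupp.degree_eq_sum, Fin.sum_univ_two])
  have : Fintype {c : Fin 2 →₀ ℕ // c.degree = k} := Fintype.ofEquiv _ e0.symm
  let e : homogeneousSubmodule (Fin 2) K k ≃ₗ[K] ({c : Fin 2 →₀ ℕ // c.degree = k} → K) :=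
    { toFun := fun f c => coeff c.1 f.1
      map_add' := fun f g => by ext c; simp
      map_smul' := fun r f => by ext c; simp
      invFun := fun v => ⟨∑ c, monomial c.1 (v c), by
        refine Submodule.sum_mem _ fun c _ => ?_
        exact isHomogeneous_monomial _ c.2⟩
      left_inv := by
        intro f
        ext m
        simp only [coeff_sum, coeff_monomial]
        by_cases hm : m.degree = k
        · rw [Finset.sum_eq_single (⟨m, hm⟩ : {c : Fin 2 →₀ ℕ // c.degree = k})]
          · simp
          · intro b _ hb
            rw [if_neg]
            intro h
            exact hb (Subtype.ext h)
          · simp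
        · rw [Finset.sum_eq_zero]
          · exact (IsHomogeneous.coeff_eq_zero f.2 hm).symm
          · intro b _
            rw [if_neg]
            rintro rfl
            exact hm b.2
      right_inv := by
        intro v
        ext m
        simp only [coeff_sum, coeff_monomial]
        rw [Finset.sum_eq_single m]
        · simp
        · intro b _ hb
          rw [if_neg]
          intro h
          exact hb (Subtype.ext h)
        · simp }
  refine ⟨?_, Module.Finite.equiv e.symm⟩
  rw [e.finrank_eq, Module.finrank_fintype_fun_eq_card, Fintype.card_congr e0, Fintype.card_coe,
    Finset.Nat.card_antidiagonal]

/-- Two coprime binary forms of degree `d` generate all forms of degree at least `2 d - 1`.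
In degree `2 d - 1` the map `(α, β) ↦ α f + β g` on pairs of forms of degree `d - 1` is injective
between spaces of dimension `2 d`. -/
theorem exists_eq_mul_add_mul_of_isRelPrime {f g c : MvPolynomial (Fin 2) K} {d : ℕ} (hd : 1 ≤ d)
    (hf : IsHomogeneousOfDegree f d) (hg : IsHomogeneousOfDegree g d) (hfg : IsRelPrime f g)
    {e : ℤ} (he : (d : ℤ) - 1 ≤ e) (hc : IsHomogeneousOfDegree c (e + d)) :
    ∃ α β, IsHomogeneousOfDegree α e ∧ IsHomogeneousOfDegree β e ∧ c = α * f + β * g := by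
  have hf0 : f ≠ 0 := by
    rintro rfl
    have h1 : IsUnit g := hfg (dvd_zero _) dvd_rfl
    have h2 := hg.constantCoeff_eq_zero (by omega)
    exact (h1.map constantCoeff).ne_zero h2
  have hg0 : g ≠ 0 := by
    rintro rfl
    have h1 : IsUnit f := hfg dvd_rfl (dvd_zero _)
    have h2 := hf.constantCoeff_eq_zero (by omega)
    exact (h1.map constantCoeff).ne_zero h2
  obtain ⟨n, rfl⟩ : ∃ n : ℕ, e = (d : ℤ) - 1 + n := ⟨(e - (d - 1)).toNat, by omega⟩
  clear he
  induction n generalizing c with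
  | zero =>
    have hdd : (((d - 1 : ℕ) : ℤ)) = (d : ℤ) - 1 + (0 : ℕ) := by omega
    have hdd2 : (((2 * d - 1 : ℕ) : ℤ)) = (d : ℤ) - 1 + (0 : ℕ) + d := by omega
    obtain ⟨r1, i1⟩ := finrank_homogeneousSubmodule_fin_two (K := K) (d - 1)
    obtain ⟨r2, i2⟩ := finrank_homogeneousSubmodule_fin_two (K := K) (2 * d - 1)
    let L : (homogeneousSubmodule (Fin 2) K (d - 1) × homogeneousSubmodule (Fin 2) K (d - 1)) →ₗ[K]
        homogeneousSubmodule (Fin 2) K (2 * d - 1) :=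
      { toFun := fun v => ⟨v.1.1 * f + v.2.1 * g, by
          have h1 : IsHomogeneousOfDegree v.1.1 ((d - 1 : ℕ) : ℤ) :=
            isHomogeneousOfDegree_natCast.2 v.1.2
          have h2 : IsHomogeneousOfDegree v.2.1 ((d - 1 : ℕ) : ℤ) :=
            isHomogeneousOfDegree_natCast.2 v.2.2
          exact isHomogeneousOfDegree_natCast.1
            (((h1.mul hf).add (h2.mul hg)).congr (by omega))⟩
        map_add' := fun v w => by ext1; simp; ring
        map_smul' := fun r v => by ext1; simp }
    have hL : Function.Injective L := by
      rw [injective_iff_map_eq_zero]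
      rintro ⟨⟨α, hα⟩, ⟨β, hβ⟩⟩ h
      have h : α * f + β * g = 0 := congrArg Subtype.val h
      have hα' : IsHomogeneousOfDegree α ((d - 1 : ℕ) : ℤ) := isHomogeneousOfDegree_natCast.2 hα
      have hdvd : g ∣ α := by
        refine hfg.symm.dvd_of_dvd_mul_right (z := f) ?_
        exact ⟨-β, by linear_combination h⟩
      obtain ⟨γ, rfl⟩ := hdvd
      have hγ : γ = 0 := (hg.of_mul hg0 hα').eq_zero_of_neg (by omega)
      subst hγ
      have : β = 0 := by simpa [hg0] using h
      subst this
      simp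
    have hsurj : Function.Surjective L := by
      rw [← LinearMap.injective_iff_surjective_of_finrank_eq_finrank]
      · exact hL
      · rw [Module.finrank_prod, r1, r2]; omega
    obtain ⟨⟨α, β⟩, h⟩ := hsurj ⟨c, isHomogeneousOfDegree_natCast.1 (hc.congr hdd2.symm)⟩
    exact ⟨α, β, (isHomogeneousOfDegree_natCast.2 α.2).congr hdd,
      (isHomogeneousOfDegree_natCast.2 β.2).congr hdd, (congrArg Subtype.val h).symm⟩
  | succ n ih =>
    obtain ⟨c', hc', rfl⟩ := hc.exists_eq_sum_X_mul (hc.constantCoeff_eq_zero (by omega))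
    have := fun j => ih ((hc' j).congr (by push_cast; ring))
    choose α β hα hβ h using this
    refine ⟨∑ j, X j * α j, ∑ j, X j * β j,
      .sum fun j _ => ((isHomogeneousOfDegree_X j).mul (hα j)).congr (by push_cast; ring),
      .sum fun j _ => ((isHomogeneousOfDegree_X j).mul (hβ j)).congr (by push_cast; ring), ?_⟩
    rw [Finset.sum_mul, Finset.sum_mul, ← Finset.sum_add_distrib]
    refine Finset.sum_congr rfl fun j _ => ?_
    rw [h j]
    ring

end BinaryForms

/-! ### Restriction to a line -/

section Slice

variable {K : Type*} [Field K]

theorem IsHomogeneousOfDegree.map_algHom {σ τ : Type*}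
    {φ : MvPolynomial σ K →ₐ[K] MvPolynomial τ K}
    (hφ : ∀ i, IsHomogeneousOfDegree (φ (X i)) 1) {f : MvPolynomial σ K} {n : ℤ}
    (hf : IsHomogeneousOfDegree f n) : IsHomogeneousOfDegree (φ f) n := by
  rcases lt_or_ge n 0 with hn | hn
  · rw [hf.eq_zero_of_neg hn, map_zero]
    exact isHomogeneousOfDegree_zero n
  · lift n to ℕ using hn
    rw [isHomogeneousOfDegree_natCast] at hf ⊢
    have := hf.aeval (fun i => φ (X i)) (n := 1)
      (fun i => isHomogeneousOfDegree_natCast.1 (hφ i))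
    rw [one_mul] at this
    convert this using 1
    rw [← MvPolynomial.comp_aeval_apply, aeval_X_left_apply]

/-- The linear form `u - α s - β t`. -/
noncomputable def linForm (α β : K) : MvPolynomial (Fin 3) K := X 2 - (C α * X 0 + C β * X 1)

/-- Restriction to the line `u = α s + β t`, with coordinates `s, t`. -/
noncomputable def slice (α β : K) : MvPolynomial (Fin 3) K →ₐ[K] MvPolynomial (Fin 2) K :=
  aeval ![X 0, X 1, C α * X 0 + C β * X 1]

/-- The inclusion `K[s, t] → K[s, t, u]`, a section of every `slice α β`. -/
noncomputable def incl : MvPolynomial (Fin 2) K →ₐ[K] MvPolynomial (Fin 3) K :=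
  aeval ![X 0, X 1]

variable (α β : K)

@[simp] theorem slice_X_zero : slice α β (X 0) = X 0 := by simp [slice]
@[simp] theorem slice_X_one : slice α β (X 1) = X 1 := by simp [slice]
@[simp] theorem slice_X_two : slice α β (X 2) = C α * X 0 + C β * X 1 := by simp [slice]
@[simp] theorem slice_C (r : K) : slice α β (C r) = C r := by simp [slice]
@[simp] theorem incl_X_zero : incl (X 0 : MvPolynomial (Fin 2) K) = X 0 := by simp [incl]
@[simp] theorem incl_X_one : incl (X 1 : MvPolynomial (Fin 2) K) = X 1 := by simp [incl]
@[simp] theorem incl_C (r : K) : incl (C r : MvPolynomial (Fin 2) K) = C r := by simp [incl]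

@[simp] theorem slice_linForm : slice α β (linForm α β) = 0 := by simp [linForm]

@[simp] theorem slice_incl (f : MvPolynomial (Fin 2) K) : slice α β (incl f) = f := by
  have : (slice α β).comp incl = AlgHom.id K (MvPolynomial (Fin 2) K) := by
    ext i
    fin_cases i <;> simp
  exact DFunLike.congr_fun this f

theorem exists_eq_incl_slice_add (f : MvPolynomial (Fin 3) K) :
    ∃ r, f = incl (slice α β f) + linForm α β * r := by
  have h : ((Ideal.Quotient.mkₐ K (Ideal.span {linForm α β})).comp (incl.comp (slice α β))) =
      Ideal.Quotient.mkₐ K (Ideal.span {linForm α β}) := by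
    ext i
    fin_cases i
    · simp
    · simp
    · simp only [Fin.reduceFinMk, AlgHom.comp_apply, slice_X_two, Ideal.Quotient.mkₐ_eq_mk]
      refine (Ideal.Quotient.eq.2 ?_).symm
      rw [Ideal.mem_span_singleton]
      simp [linForm]
  have h1 := DFunLike.congr_fun h f
  simp only [AlgHom.comp_apply, Ideal.Quotient.mkₐ_eq_mk] at h1
  have h2 := Ideal.Quotient.eq.1 h1.symm
  rw [Ideal.mem_span_singleton] at h2
  obtain ⟨r, hr⟩ := h2
  exact ⟨r, by rw [← hr]; ring⟩

theorem linForm_dvd_iff {f : MvPolynomial (Fin 3) K} :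
    linForm α β ∣ f ↔ slice α β f = 0 := by
  constructor
  · rintro ⟨r, rfl⟩
    simp
  · intro h
    obtain ⟨r, hr⟩ := exists_eq_incl_slice_add α β f
    rw [h, map_zero, zero_add] at hr
    exact ⟨r, hr⟩

/-- Polynomials with the same restriction differ by a multiple of the linear form. -/
theorem exists_eq_add_of_slice_eq {f g : MvPolynomial (Fin 3) K}
    (h : slice α β f = slice α β g) : ∃ r, f = g + linForm α β * r := by
  obtain ⟨r, hr⟩ := (linForm_dvd_iff α β (f := f - g)).2 (by rw [map_sub, h, sub_self])
  exact ⟨r, by rw [← hr]; ring⟩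

theorem linForm_ne_zero : linForm α β ≠ 0 := by
  intro h
  have := congrArg (eval ![0, 0, 1]) h
  simp [linForm] at this

theorem isHomogeneousOfDegree_linForm : IsHomogeneousOfDegree (linForm α β) 1 := by
  have hC : ∀ (r : K) (i : Fin 3), IsHomogeneousOfDegree (C r * X i) 1 := fun r i =>
    ((isHomogeneousOfDegree_C r).mul (isHomogeneousOfDegree_X i)).congr (by norm_num)
  exact (isHomogeneousOfDegree_X 2).sub ((hC _ _).add (hC _ _))

variable {α β}

theorem IsHomogeneousOfDegree.slice {f : MvPolynomial (Fin 3) K} {n : ℤ}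
    (hf : IsHomogeneousOfDegree f n) (α β : K) : IsHomogeneousOfDegree (slice α β f) n := by
  have hC : ∀ (r : K) (i : Fin 2), IsHomogeneousOfDegree (C r * X i) 1 := fun r i =>
    ((isHomogeneousOfDegree_C r).mul (isHomogeneousOfDegree_X i)).congr (by norm_num)
  refine hf.map_algHom fun i => ?_
  fin_cases i
  · simpa using isHomogeneousOfDegree_X 0
  · simpa using isHomogeneousOfDegree_X 1
  · simpa using (hC _ _).add (hC _ _)

theorem IsHomogeneousOfDegree.incl {f : MvPolynomial (Fin 2) K} {n : ℤ}
    (hf : IsHomogeneousOfDegree f n) : IsHomogeneousOfDegree (incl f) n := by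
  refine hf.map_algHom fun i => ?_
  fin_cases i
  · simpa using isHomogeneousOfDegree_X 0
  · simpa using isHomogeneousOfDegree_X 1

end Slice

/-! ### General lines and general members of a linear system -/

section General

variable {K : Type*} [Field K]


theorem exists_notMem_of_forall_ne_top [Infinite K] {E ι : Type*} [AddCommGroup E] [Module K E] [Finite ι]
    (p : ι → Submodule K E) (hp : ∀ i, p i ≠ ⊤) : ∃ v, ∀ i, v ∉ p i := by
  by_contra! h
  obtain ⟨i, hi⟩ := Subspace.exists_eq_top_of_iUnion_eq_univ (p := p)
    (Set.eq_univ_of_forall fun v => Set.mem_iUnion.2 (h v))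
  exact hp i hi

theorem false_of_dvd_X_zero_of_dvd_X_one {w : MvPolynomial (Fin 2) K} (hw : Prime w) (h0 : w ∣ X 0)
    (h1 : w ∣ X 1) : False := by
  have hp0 : Prime (X 0 : MvPolynomial (Fin 2) K) := X_prime
  have hp1 : Prime (X 1 : MvPolynomial (Fin 2) K) := X_prime
  have h2 : (X 0 : MvPolynomial (Fin 2) K) ∣ X 1 :=
    ((hw.associated_of_dvd hp0 h0).dvd_iff_dvd_left).1 h1
  rw [X_dvd_X] at h2
  simp at h2

/-- If the `b i` have no common prime factor, neither have their restrictions to a general line.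
For forms, the zeros of the ideal `I` of the `b i` are finitely many points of the projective plane,
and a line that misses them works. Algebraically, the linear form is chosen outside the minimal
primes of `I`, except the one of the origin; the prime ideal of a common factor on the line has
height at most two, so that it would be a minimal prime of `I`. -/
theorem exists_slice_no_common_prime [Infinite K] {ι : Type*} (b : ι → MvPolynomial (Fin 3) K)
    (hb : ∀ ρ, Prime ρ → ¬ ∀ i, ρ ∣ b i) :
    ∃ α β : K, ∀ w, Prime w → ¬ ∀ i, w ∣ slice α β (b i) := by
  classical
  set I := Ideal.span (Set.range b) with hI
  have hI0 : I ≠ ⊥ := by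
    intro h
    refine hb (X 0) X_prime fun i => ?_
    have : b i ∈ I := Ideal.subset_span ⟨i, rfl⟩
    rw [h, Ideal.mem_bot] at this
    simp [this]
  have : Finite I.minimalPrimes := I.finite_minimalPrimes_of_isNoetherianRing
  let lin : (Fin 3 → K) →ₗ[K] MvPolynomial (Fin 3) K :=
    Fintype.linearCombination K (fun i : Fin 3 => (X i : MvPolynomial (Fin 3) K))
  -- The linear forms in each minimal prime to be avoided, and those with no term in `X 2`.
  let p : Option {P : I.minimalPrimes // ¬ ∀ i, X i ∈ P.1} → Submodule K (Fin 3 → K) := fun o =>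
    match o with
    | none => LinearMap.ker (LinearMap.proj 2)
    | some P => (P.1.1.restrictScalars K).comap lin
  obtain ⟨v, hv⟩ := exists_notMem_of_forall_ne_top p (by
    rintro (_ | P) h
    · have : (Pi.single 2 1 : Fin 3 → K) ∈ p none := by rw [h]; trivial
      simp [p] at this
    · refine P.2 fun i => ?_
      have : (Pi.single i 1 : Fin 3 → K) ∈ p (some P) := by rw [h]; trivial
      simpa [p, lin, Fintype.linearCombination_apply_single] using this)
  have hv2 : v 2 ≠ 0 := by simpa [p] using hv none
  refine ⟨-(v 0 / v 2), -(v 1 / v 2), fun w hw hdvd => ?_⟩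
  set α := -(v 0 / v 2)
  set β := -(v 1 / v 2)
  have hlin : lin v = C (v 2) * linForm α β := by
    have h0 : v 0 = - (v 2 * α) := by simp [α]; field_simp
    have h1 : v 1 = - (v 2 * β) := by simp [β]; field_simp
    simp only [lin, Fintype.linearCombination_apply, Fin.sum_univ_three, linForm]
    rw [h0, h1]
    simp only [smul_eq_C_mul, map_neg, map_mul]
    ring
  have hwp : (Ideal.span {w}).IsPrime := (Ideal.span_singleton_prime hw.ne_zero).2 hw
  let Q : Ideal (MvPolynomial (Fin 3) K) := (Ideal.span {w}).comap (slice α β)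
  have hQp : Q.IsPrime := Ideal.comap_isPrime _ _
  have hQ : Q = Ideal.span {linForm α β, incl w} := by
    apply le_antisymm
    · intro f hf
      obtain ⟨r, hr⟩ := exists_eq_incl_slice_add α β f
      have : slice α β f ∈ Ideal.span {w} := hf
      obtain ⟨c, hc⟩ := Ideal.mem_span_singleton.1 this
      rw [Ideal.mem_span_pair]
      refine ⟨r, incl c, ?_⟩
      rw [hr, hc, map_mul]
      ring
    · rw [Ideal.span_le]
      rintro x (rfl | rfl)
      · simp [Q]
      · simp [Q]
  have hQ2 : Q.height ≤ (2 : ℕ) := by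
    have h1 : Q ∈ (Ideal.span {linForm α β, incl w}).minimalPrimes := by
      rw [← hQ, Ideal.minimalPrimes_eq_subsingleton_self]
      rfl
    refine (Ideal.height_le_card_of_mem_minimalPrimes_span (Set.toFinite _) h1).trans ?_
    exact_mod_cast (Set.ncard_insert_le _ _).trans (by rw [Set.ncard_singleton])
  have hIQ : I ≤ Q := by
    rw [Ideal.span_le]
    rintro _ ⟨i, rfl⟩
    exact Ideal.mem_span_singleton.2 (hdvd i)
  obtain ⟨P, hP, hPQ⟩ := Ideal.exists_minimalPrimes_le hIQ
  have hPp : P.IsPrime := hP.1.1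
  have hIP : I ≤ P := hP.1.2
  rcases hPQ.eq_or_lt with h | hlt
  · -- The line misses the zero of `P`, so that `P` is the ideal of the origin.
    have hX : ∀ i, X i ∈ P := by
      by_contra hX
      have := hv (some ⟨⟨P, hP⟩, hX⟩)
      apply this
      change lin v ∈ P
      rw [hlin, h]
      exact Ideal.mul_mem_left _ _ (by simp [Q])
    rw [h] at hX
    exact false_of_dvd_X_zero_of_dvd_X_one hw (by simpa [Q, Ideal.mem_span_singleton] using hX 0)
      (by simpa [Q, Ideal.mem_span_singleton] using hX 1)
  · -- Otherwise `P` has height one, and its generator divides all the `b i`.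
    have hP2 : P.height ≤ (1 : ℕ) := by
      have := Ideal.height_le_iff.1 hQ2 P hPp hlt
      rw [Nat.cast_ofNat, ← one_add_one_eq_two] at this
      exact_mod_cast Order.le_of_lt_add_one this
    have hP0 : P ≠ ⊥ := by
      rintro rfl
      exact hI0 (le_bot_iff.1 hIP)
    obtain ⟨ρ, hρP, hρ⟩ := hPp.exists_mem_prime_of_ne_bot hP0
    have hρp : (Ideal.span {ρ}).IsPrime := (Ideal.span_singleton_prime hρ.ne_zero).2 hρ
    have hle : Ideal.span {ρ} ≤ P := by
      rw [Ideal.span_le]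
      simpa using hρP
    rcases hle.eq_or_lt with h | hlt'
    · refine hb ρ hρ fun i => ?_
      rw [← Ideal.mem_span_singleton, h]
      exact hIP (Ideal.subset_span ⟨i, rfl⟩)
    · have h1 : (Ideal.span {ρ}).height ≤ (0 : ℕ) := by
        have := Ideal.height_le_iff.1 hP2 _ hρp hlt'
        rw [Nat.cast_one] at this
        exact_mod_cast (Order.lt_one_iff.1 this).le
      have h2 := Ideal.height_le_iff.1 h1 ⊥ Ideal.isPrime_bot
        (bot_lt_iff_ne_bot.2 (by simpa using hρ.ne_zero))
      simp at h2

/-- Polynomials without a common prime factor have two coprime linear combinations, by prime avoidance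
among the prime factors of one of them. -/
theorem exists_isRelPrime_linear_combination [Infinite K] {σ ι : Type*} [Fintype ι]
    (b : ι → MvPolynomial σ K) [UniqueFactorizationMonoid (MvPolynomial σ K)]
    (h0 : ∃ i, b i ≠ 0) (hb : ∀ ρ, Prime ρ → ¬ ∀ i, ρ ∣ b i) :
    ∃ μ ν : ι → K, IsRelPrime (∑ i, C (μ i) * b i) (∑ i, C (ν i) * b i) := by
  classical
  obtain ⟨j, hj⟩ := h0
  let s : Finset (MvPolynomial σ K) := (UniqueFactorizationMonoid.factors (b j)).toFinset
  let lin : (ι → K) →ₗ[K] MvPolynomial σ K := Fintype.linearCombination K b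
  have hlin : ∀ v, lin v = ∑ i, C (v i) * b i := fun v => by
    simp [lin, Fintype.linearCombination_apply, smul_eq_C_mul]
  obtain ⟨v, hv⟩ := exists_notMem_of_forall_ne_top
    (fun w : s => ((Ideal.span {w.1}).restrictScalars K).comap lin) (by
      rintro ⟨w, hw⟩ h
      have hwp : Prime w := UniqueFactorizationMonoid.prime_of_factor _ (Multiset.mem_toFinset.1 hw)
      refine hb w hwp fun i => ?_
      have : (Pi.single i 1 : ι → K) ∈ ((Ideal.span {w}).restrictScalars K).comap lin := by
        rw [h]; trivial
      simpa [lin, Fintype.linearCombination_apply_single, Ideal.mem_span_singleton] using this)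
  refine ⟨Pi.single j 1, v, ?_⟩
  rw [← hlin, ← hlin]
  have : lin (Pi.single j 1) = b j := by simp [lin, Fintype.linearCombination_apply_single]
  rw [this]
  refine UniqueFactorizationMonoid.isRelPrime_iff_no_prime_factors hj |>.2 ?_
  intro w h1 h2 hw
  obtain ⟨w', hw', hass⟩ := UniqueFactorizationMonoid.exists_mem_factors_of_dvd hj hw.irreducible h1
  refine hv ⟨w', Multiset.mem_toFinset.2 hw'⟩ ?_
  change lin v ∈ Ideal.span {w'}
  rw [Ideal.mem_span_singleton]
  exact hass.symm.dvd.trans h2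

end General

/-! ### Syzygies and relations between syzygies in high degrees -/

section Regularity

variable {K : Type*} [Field K] {ι : Type*} [Fintype ι]

/-- The data of a general line and of two general elements `F`, `G` of the linear system spanned by
the forms `b i` of degree `d`: the restrictions of `F` and `G` to the line `u = α s + β t` are
coprime. The coefficients of `F` and `G` are `μ` and `ν`. The degree `d` is positive. -/
structure GeneralLine (b : ι → MvPolynomial (Fin 3) K) (d : ℕ) (α β : K)
    (F G : MvPolynomial (Fin 3) K) (μ ν : ι → K) : Prop where
  one_le : 1 ≤ d
  homogeneous : ∀ i, IsHomogeneousOfDegree (b i) d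
  left_eq : ∑ i, C (μ i) * b i = F
  right_eq : ∑ i, C (ν i) * b i = G
  isRelPrime : IsRelPrime (slice α β F) (slice α β G)

namespace GeneralLine

variable {b : ι → MvPolynomial (Fin 3) K} {d : ℕ} {α β : K}
  {F G : MvPolynomial (Fin 3) K} {μ ν : ι → K}

theorem homogeneous_comb (h : GeneralLine b d α β F G μ ν) (μ' : ι → K) :
    IsHomogeneousOfDegree (∑ i, C (μ' i) * b i) d :=
  .sum fun i _ => ((isHomogeneousOfDegree_C _).mul (h.homogeneous i)).congr (by ring)

theorem homogeneous_left (h : GeneralLine b d α β F G μ ν) : IsHomogeneousOfDegree F d := by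
  rw [← h.left_eq]
  exact h.homogeneous_comb μ

theorem homogeneous_right (h : GeneralLine b d α β F G μ ν) : IsHomogeneousOfDegree G d := by
  rw [← h.right_eq]
  exact h.homogeneous_comb ν

theorem slice_right_ne_zero (h : GeneralLine b d α β F G μ ν) : slice α β G ≠ 0 := by
  intro h0
  have h1 : IsUnit (slice α β F) := h.isRelPrime dvd_rfl (h0 ▸ dvd_zero _)
  have h2 := (h.homogeneous_left.slice α β).constantCoeff_eq_zero (by have := h.one_le; omega)
  exact (h1.map constantCoeff).ne_zero h2

theorem exists_slice_eq (h : GeneralLine b d α β F G μ ν) {e : ℤ} (he : (d : ℤ) - 1 ≤ e)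
    {c : MvPolynomial (Fin 2) K} (hc : IsHomogeneousOfDegree c (e + d)) :
    ∃ x y : MvPolynomial (Fin 3) K, IsHomogeneousOfDegree x e ∧ IsHomogeneousOfDegree y e ∧
      c = slice α β (x * F + y * G) := by
  obtain ⟨x, y, hx, hy, hxy⟩ := exists_eq_mul_add_mul_of_isRelPrime h.one_le
    (h.homogeneous_left.slice α β) (h.homogeneous_right.slice α β) h.isRelPrime he hc
  exact ⟨incl x, incl y, hx.incl, hy.incl, by simp [hxy]⟩

/-- Since `F` and `G` are coprime on the line, the relations between them modulo the linear form
are the multiples of the Koszul relation. -/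
theorem exists_eq_of_slice_eq_zero (h : GeneralLine b d α β F G μ ν)
    {x y : MvPolynomial (Fin 3) K} (hxy : slice α β (x * F + y * G) = 0) :
    ∃ γ : MvPolynomial (Fin 2) K, slice α β x = slice α β G * γ ∧
      ∃ x' y', x = G * incl γ + linForm α β * x' ∧ y = -(F * incl γ) + linForm α β * y' := by
  simp only [map_add, map_mul] at hxy
  have hdvd : slice α β G ∣ slice α β x :=
    h.isRelPrime.symm.dvd_of_dvd_mul_right (z := slice α β F)
      ⟨-slice α β y, by linear_combination hxy⟩
  obtain ⟨γ, hγ⟩ := hdvd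
  have hy : slice α β y = - (slice α β F * γ) := by
    refine mul_left_cancel₀ h.slice_right_ne_zero ?_
    rw [hγ] at hxy
    linear_combination hxy
  obtain ⟨x', hx'⟩ := exists_eq_add_of_slice_eq α β (f := x) (g := G * incl γ) (by simp [hγ])
  obtain ⟨y', hy'⟩ := exists_eq_add_of_slice_eq α β (f := y) (g := -(F * incl γ)) (by simp [hy])
  exact ⟨γ, hγ, x', y', hx', hy'⟩

/-- The ideal of the `b i` is saturated with respect to the linear form in degrees at least
`3 d - 2`: in an expression of `l h` by the `b i` the coefficients have degree at least `2 d - 1`,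
so they lie in `(F, G, l)`, and `F`, `G`, `l` is a regular sequence. -/
theorem exists_eq_sum_of_linForm_mul_eq (hgl : GeneralLine b d α β F G μ ν)
    {h : MvPolynomial (Fin 3) K} {n : ℤ} (hn : 3 * (d : ℤ) - 2 ≤ n)
    (hh : IsHomogeneousOfDegree h n) {c : ι → MvPolynomial (Fin 3) K}
    (hc : linForm α β * h = ∑ i, c i * b i) : ∃ r : ι → MvPolynomial (Fin 3) K,
      h = ∑ i, r i * b i := by
  -- The coefficients may be replaced by their components of the expected degree.
  wlog hcn : ∀ i, IsHomogeneousOfDegree (c i) (n + 1 - d) generalizing c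
  · refine this (c := fun i => gcomp (n + 1 - d) (c i)) ?_
      fun i => isHomogeneousOfDegree_gcomp _ _
    have h1 : IsHomogeneousOfDegree (linForm α β * h) (n + 1) :=
      ((isHomogeneousOfDegree_linForm α β).mul hh).congr (by ring)
    rw [← h1.gcomp_eq, hc, map_sum]
    refine Finset.sum_congr rfl fun i _ => ?_
    rw [mul_comm, (hgl.homogeneous i).gcomp_mul, mul_comm]
  have h1 := fun i => hgl.exists_slice_eq (e := n + 1 - d - d) (by omega)
    (((hcn i).slice α β).congr (by ring))
  choose x y _ _ hxy using h1
  choose r hr using fun i => exists_eq_add_of_slice_eq α β (hxy i)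
  have hsum : linForm α β * h = (∑ i, x i * b i) * F + (∑ i, y i * b i) * G +
      linForm α β * ∑ i, r i * b i := by
    rw [hc, Finset.sum_mul, Finset.sum_mul, Finset.mul_sum, ← Finset.sum_add_distrib,
      ← Finset.sum_add_distrib]
    refine Finset.sum_congr rfl fun i _ => ?_
    rw [hr i]
    ring
  have h0 : slice α β ((∑ i, x i * b i) * F + (∑ i, y i * b i) * G) = 0 := by
    rw [← linForm_dvd_iff]
    exact ⟨h - ∑ i, r i * b i, by linear_combination -hsum⟩
  obtain ⟨γ, _, x', y', hx', hy'⟩ := hgl.exists_eq_of_slice_eq_zero h0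
  rw [hx', hy'] at hsum
  have hfin : h = x' * F + y' * G + ∑ i, r i * b i :=
    mul_left_cancel₀ (linForm_ne_zero α β) (by linear_combination hsum)
  refine ⟨fun i => x' * C (μ i) + y' * C (ν i) + r i, ?_⟩
  rw [hfin, ← hgl.left_eq, ← hgl.right_eq, Finset.mul_sum, Finset.mul_sum,
    ← Finset.sum_add_distrib, ← Finset.sum_add_distrib]
  exact Finset.sum_congr rfl fun i _ => by ring

/-- A combination of `X 0`, `X 1` and the linear form is one of the three variables. -/
theorem eq_sum_X_mul (α β : K) (x y r : MvPolynomial (Fin 3) K) :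
    X 0 * x + X 1 * y + linForm α β * r =
      ∑ j : Fin 3, X j * (![x - C α * r, y - C β * r, r] j) := by
  simp only [Fin.sum_univ_three, linForm, Matrix.cons_val]
  ring

/-- A syzygy with entries of degree at least `2 d` is a combination of syzygies with coefficients
in the maximal ideal. Modulo the linear form its entries lie in `𝔪 (F, G)`, and subtracting
Koszul syzygies leaves a relation between `F` and `G`, again a multiple of a Koszul syzygy. -/
theorem exists_syzygy_eq_sum_X_mul (hgl : GeneralLine b d α β F G μ ν)
    {e : ℤ} (he : 2 * (d : ℤ) ≤ e) {c : ι → MvPolynomial (Fin 3) K}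
    (hc : ∀ i, IsHomogeneousOfDegree (c i) e) (hsyz : ∑ i, c i * b i = 0) :
    ∃ s : Fin 3 → ι → MvPolynomial (Fin 3) K, (∀ j, ∑ i, s j i * b i = 0) ∧
      ∀ i, c i = ∑ j, X j * s j i := by
  have hd := hgl.one_le
  have h1 := fun i => ((hc i).slice α β).exists_eq_sum_X_mul
    (((hc i).slice α β).constantCoeff_eq_zero (by omega))
  choose t ht hct using h1
  have h2 := fun i j => hgl.exists_slice_eq (e := e - 1 - d) (by omega)
    ((ht i j).congr (by ring))
  choose x y hx hy hxy using h2
  -- The part of `c` modulo the linear form that lies in `𝔪 (F, G)`, and the rest `r`.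
  have h3 := fun i => exists_eq_add_of_slice_eq α β (f := c i)
    (g := X 0 * (x i 0 * F + y i 0 * G) + X 1 * (x i 1 * F + y i 1 * G)) (by
      rw [hct i, Fin.sum_univ_two, hxy, hxy]; simp)
  choose r hr using h3
  -- The Koszul syzygies between `F`, `G` and the `b i`.
  let s : Fin 2 → ι → MvPolynomial (Fin 3) K := fun j i =>
    (x i j * F - (∑ k, x k j * b k) * C (μ i)) + (y i j * G - (∑ k, y k j * b k) * C (ν i))
  have hs : ∀ j, ∑ i, s j i * b i = 0 := by
    intro j
    have : ∀ i, s j i * b i = (x i j * b i) * F - (∑ k, x k j * b k) * (C (μ i) * b i) +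
        ((y i j * b i) * G - (∑ k, y k j * b k) * (C (ν i) * b i)) := fun i => by
      simp only [s]; ring
    rw [Finset.sum_congr rfl fun i _ => this i, Finset.sum_add_distrib, Finset.sum_sub_distrib,
      Finset.sum_sub_distrib, ← Finset.sum_mul, ← Finset.sum_mul, ← Finset.mul_sum,
      ← Finset.mul_sum, hgl.left_eq, hgl.right_eq]
    ring
  -- What remains of `c` after subtracting these syzygies involves only the coefficient vectors
  -- `μ`, `ν` of `F`, `G`, with factors `A`, `B`, and a multiple of the linear form.
  let A := X 0 * (∑ k, x k 0 * b k) + X 1 * (∑ k, x k 1 * b k)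
  let B := X 0 * (∑ k, y k 0 * b k) + X 1 * (∑ k, y k 1 * b k)
  have hA : IsHomogeneousOfDegree A e := by
    have (j : Fin 2) : IsHomogeneousOfDegree (∑ k, x k j * b k) (e - 1) :=
      .sum fun k _ => ((hx k j).mul (hgl.homogeneous k)).congr (by ring)
    exact (((isHomogeneousOfDegree_X 0).mul (this 0)).congr (by ring)).add
      (((isHomogeneousOfDegree_X 1).mul (this 1)).congr (by ring))
  have hc' : ∀ i, c i = X 0 * s 0 i + X 1 * s 1 i + (A * C (μ i) + B * C (ν i)) +
      linForm α β * r i := fun i => by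
    rw [hr i]; simp only [s, A, B]; ring
  have hAB : A * F + B * G + linForm α β * ∑ i, r i * b i = 0 := by
    have : ∀ i, c i * b i = X 0 * (s 0 i * b i) + X 1 * (s 1 i * b i) +
        (A * (C (μ i) * b i) + B * (C (ν i) * b i)) + linForm α β * (r i * b i) := fun i => by
      rw [hc' i]; ring
    rw [Finset.sum_congr rfl fun i _ => this i] at hsyz
    simp only [Finset.sum_add_distrib, ← Finset.mul_sum, hs, hgl.left_eq, hgl.right_eq] at hsyz
    linear_combination hsyz
  obtain ⟨γ, hγ, A', B', hA', hB'⟩ := hgl.exists_eq_of_slice_eq_zero (x := A) (y := B) (by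
    rw [← linForm_dvd_iff]
    exact ⟨-∑ i, r i * b i, by linear_combination hAB⟩)
  -- `A` has degree `e ≥ 2 d` and `G` has degree `d < e`, so `γ` has no constant term.
  have hγ0 : constantCoeff γ = 0 :=
    (hgl.homogeneous_right.slice α β).constantCoeff_eq_zero_of_mul hgl.slice_right_ne_zero
      (hγ ▸ hA.slice α β) (by omega)
  obtain ⟨δ, hδ⟩ := exists_eq_sum_X_mul hγ0
  rw [Fin.sum_univ_two] at hδ
  let r' : ι → MvPolynomial (Fin 3) K := fun i => A' * C (μ i) + B' * C (ν i) + r i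
  let s' : Fin 2 → ι → MvPolynomial (Fin 3) K := fun j i =>
    s j i + incl (δ j) * (G * C (μ i) - F * C (ν i))
  have hs' : ∀ j, ∑ i, s' j i * b i = 0 := by
    intro j
    have : ∀ i, s' j i * b i = s j i * b i +
        incl (δ j) * (G * (C (μ i) * b i) - F * (C (ν i) * b i)) := fun i => by
      simp only [s']; ring
    rw [Finset.sum_congr rfl fun i _ => this i]
    simp only [Finset.sum_add_distrib, ← Finset.mul_sum, Finset.sum_sub_distrib, hs, hgl.left_eq,
      hgl.right_eq]
    ring
  have hc'' : ∀ i, c i = X 0 * s' 0 i + X 1 * s' 1 i + linForm α β * r' i := fun i => by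
    rw [hc' i, hA', hB', hδ]
    simp only [s', r', map_add, map_mul, incl_X_zero, incl_X_one]
    ring
  have hr' : ∑ i, r' i * b i = 0 := by
    refine mul_left_cancel₀ (linForm_ne_zero α β) ?_
    have : ∀ i, c i * b i = X 0 * (s' 0 i * b i) + X 1 * (s' 1 i * b i) +
        linForm α β * (r' i * b i) := fun i => by
      rw [hc'' i]; ring
    rw [Finset.sum_congr rfl fun i _ => this i] at hsyz
    simp only [Finset.sum_add_distrib, ← Finset.mul_sum, hs'] at hsyz
    linear_combination hsyz
  refine ⟨fun j i => ![s' 0 i - C α * r' i, s' 1 i - C β * r' i, r' i] j, fun j => ?_, fun i => ?_⟩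
  · have key : ∀ (z : K) (k : Fin 2), ∑ i, (s' k i - C z * r' i) * b i = 0 := by
      intro z k
      simp only [sub_mul, mul_assoc, Finset.sum_sub_distrib, ← Finset.mul_sum, hs', hr']
      ring
    fin_cases j
    · exact key α 0
    · exact key β 1
    · exact hr'
  · rw [hc'' i, eq_sum_X_mul]

open Matrix in
/-- An element of degree at least `3 d + 1` in the kernel of a presentation matrix `D` of the
syzygy module is a combination of elements of the kernel with coefficients in the maximal
ideal. Modulo the linear form it is `X 0 y₀ + X 1 y₁`, and `D y₀ = X 1 v`, `D y₁ = - X 0 v`; then `v`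
is a syzygy modulo the linear form, and it lifts to a syzygy because the ideal is saturated with
respect to the linear form in high degrees. -/
theorem exists_mem_ker_eq_sum_X_mul (hgl : GeneralLine b d α β F G μ ν)
    {κ : Type*} [Fintype κ] {D : Matrix ι κ (MvPolynomial (Fin 3) K)} {q : κ → ℤ}
    (hD : ∀ i k, IsHomogeneousOfDegree (D i k) (q k - d))
    (hex : ∀ c : ι → MvPolynomial (Fin 3) K, ∑ i, c i * b i = 0 ↔ ∃ u, D *ᵥ u = c)
    {p : ℤ} (hp : 3 * (d : ℤ) + 1 ≤ p) {y : κ → MvPolynomial (Fin 3) K}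
    (hy : ∀ k, IsHomogeneousOfDegree (y k) (p - q k)) (hy0 : ∀ k, constantCoeff (y k) = 0)
    (hDy : D *ᵥ y = 0) :
    ∃ z : Fin 3 → κ → MvPolynomial (Fin 3) K, (∀ j, D *ᵥ z j = 0) ∧
      y = ∑ j, (X j : MvPolynomial (Fin 3) K) • z j := by
  set l := linForm α β with hl
  have hl0 : l ≠ 0 := linForm_ne_zero α β
  have hccs : ∀ k, constantCoeff (slice α β (y k)) = 0 := by
    intro k
    obtain ⟨g, hg⟩ := exists_eq_sum_X_mul (hy0 k)
    rw [hg]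
    simp [Fin.sum_univ_three]
  have h1 := fun k => ((hy k).slice α β).exists_eq_sum_X_mul (hccs k)
  choose t ht hyt using h1
  let Y : Fin 2 → κ → MvPolynomial (Fin 3) K := fun j k => incl (t k j)
  have hY : ∀ j k, IsHomogeneousOfDegree (Y j k) (p - q k - 1) := fun j k => (ht k j).incl
  have h2 := fun k => exists_eq_add_of_slice_eq α β (f := y k)
    (g := X 0 * Y 0 k + X 1 * Y 1 k) (by rw [hyt k, Fin.sum_univ_two]; simp [Y])
  choose r hr using h2
  have hyr : y = (X 0 : MvPolynomial (Fin 3) K) • Y 0 + (X 1 : MvPolynomial (Fin 3) K) • Y 1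
      + l • r := by
    ext1 k
    rw [hr k]
    simp [hl]
  have hDY : ∀ i, X 0 * (D *ᵥ Y 0) i + X 1 * (D *ᵥ Y 1) i + l * (D *ᵥ r) i = 0 := by
    intro i
    have := congrFun hDy i
    rw [hyr, mulVec_add, mulVec_add, mulVec_smul, mulVec_smul, mulVec_smul] at this
    simpa using this
  have hDYs : ∀ i, X 0 * slice α β ((D *ᵥ Y 0) i) + X 1 * slice α β ((D *ᵥ Y 1) i) = 0 := by
    intro i
    simpa [hl] using congrArg (slice α β) (hDY i)
  have hX : ¬ (X 1 : MvPolynomial (Fin 2) K) ∣ X 0 := by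
    rw [X_dvd_X]; simp
  have hv : ∀ i, ∃ v, slice α β ((D *ᵥ Y 0) i) = X 1 * v := by
    intro i
    have : (X 1 : MvPolynomial (Fin 2) K) ∣ X 0 * slice α β ((D *ᵥ Y 0) i) :=
      ⟨-slice α β ((D *ᵥ Y 1) i), by linear_combination hDYs i⟩
    exact (X_prime.dvd_or_dvd this).resolve_left hX
  choose v hv0 using hv
  have hv1 : ∀ i, slice α β ((D *ᵥ Y 1) i) = - (X 0 * v i) := by
    intro i
    refine mul_left_cancel₀ (X_ne_zero (1 : Fin 2)) ?_
    have := hDYs i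
    rw [hv0 i] at this
    linear_combination this
  have hDYh : ∀ i, IsHomogeneousOfDegree ((D *ᵥ Y 0) i) (p - d - 1) := fun i =>
    .sum fun k _ => ((hD i k).mul (hY 0 k)).congr (by ring)
  have hvh : ∀ i, IsHomogeneousOfDegree (v i) (p - d - 2) := fun i =>
    ((isHomogeneousOfDegree_X 1).of_mul (X_ne_zero _)
      (hv0 i ▸ (hDYh i).slice α β)).congr (by ring)
  have hDsyz : ∀ u, ∑ i, (D *ᵥ u) i * b i = 0 := fun u => (hex _).2 ⟨u, rfl⟩
  -- The syzygy `v` modulo the linear form.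
  have hvb : slice α β (∑ i, incl (v i) * b i) = 0 := by
    refine mul_left_cancel₀ (X_ne_zero (1 : Fin 2)) ?_
    have := congrArg (slice α β) (hDsyz (Y 0))
    simp only [map_sum, map_mul, hv0, map_zero, slice_incl] at this ⊢
    rw [mul_zero, ← this, Finset.mul_sum]
    exact Finset.sum_congr rfl fun i _ => by ring
  obtain ⟨h, hh⟩ := (linForm_dvd_iff α β).2 hvb
  have hhh : IsHomogeneousOfDegree h (p - 3) := by
    have : IsHomogeneousOfDegree (∑ i, incl (v i) * b i) (p - 2) :=
      .sum fun i _ => ((hvh i).incl.mul (hgl.homogeneous i)).congr (by ring)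
    exact ((isHomogeneousOfDegree_linForm α β).of_mul hl0 (hh ▸ this)).congr (by ring)
  obtain ⟨w, hw⟩ := hgl.exists_eq_sum_of_linForm_mul_eq (by omega) hhh hh.symm
  let V : ι → MvPolynomial (Fin 3) K := fun i => incl (v i) - l * w i
  have hV : ∑ i, V i * b i = 0 := by
    simp only [V, sub_mul, mul_assoc, Finset.sum_sub_distrib, ← Finset.mul_sum]
    rw [hh, ← hw, hl, sub_self]
  have hVs : ∀ i, slice α β (V i) = v i := fun i => by simp [V, hl]
  obtain ⟨u, hu⟩ := (hex V).1 hV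
  -- Correction of the lifts `Y j` by multiples of `u` and of the linear form.
  have hcorr : ∀ (j : Fin 2) (a : MvPolynomial (Fin 3) K),
      (∀ i, slice α β ((D *ᵥ Y j) i) = slice α β (a * V i)) →
      ∃ u', D *ᵥ (Y j - a • u - l • u') = 0 := by
    intro j a ha
    choose x hx using fun i => exists_eq_add_of_slice_eq α β (ha i)
    have hxs : ∑ i, x i * b i = 0 := by
      refine mul_left_cancel₀ hl0 ?_
      have := hDsyz (Y j)
      simp only [hx, add_mul, mul_assoc, Finset.sum_add_distrib, ← Finset.mul_sum, hV] at this
      linear_combination this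
    obtain ⟨u', hu'⟩ := (hex x).1 hxs
    refine ⟨u', ?_⟩
    rw [mulVec_sub, mulVec_sub, mulVec_smul, mulVec_smul, hu, hu']
    ext1 i
    simp [hx, hl]
  obtain ⟨u₀, hu₀⟩ := hcorr 0 (X 1) fun i => by rw [hv0, map_mul, hVs, slice_X_one]
  obtain ⟨u₁, hu₁⟩ := hcorr 1 (-X 0) fun i => by
    rw [hv1, map_mul, hVs, map_neg, slice_X_zero, neg_mul]
  set z₀ := Y 0 - (X 1 : MvPolynomial (Fin 3) K) • u - l • u₀ with hz₀
  set z₁ := Y 1 - (-X 0 : MvPolynomial (Fin 3) K) • u - l • u₁ with hz₁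
  let r' := r + (X 0 : MvPolynomial (Fin 3) K) • u₀ + (X 1 : MvPolynomial (Fin 3) K) • u₁
  have hyz : y = (X 0 : MvPolynomial (Fin 3) K) • z₀ + (X 1 : MvPolynomial (Fin 3) K) • z₁
      + l • r' := by
    rw [hyr]
    ext1 k
    simp only [z₀, z₁, r', Pi.add_apply, Pi.sub_apply, Pi.smul_apply, smul_eq_mul]
    ring
  have hr' : D *ᵥ r' = 0 := by
    have := hDy
    rw [hyz, mulVec_add, mulVec_add, mulVec_smul, mulVec_smul, mulVec_smul, hu₀, hu₁, smul_zero,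
      smul_zero, zero_add, zero_add] at this
    exact (smul_eq_zero.1 this).resolve_left hl0
  refine ⟨![z₀ - (C α : MvPolynomial (Fin 3) K) • r', z₁ - (C β : MvPolynomial (Fin 3) K) • r', r'],
    fun j => ?_, ?_⟩
  · fin_cases j
    · simp only [Fin.zero_eta, cons_val]
      rw [mulVec_sub, mulVec_smul, hu₀, hr']; simp
    · simp only [Fin.mk_one, cons_val]
      rw [mulVec_sub, mulVec_smul, hu₁, hr']; simp
    · exact hr'
  · rw [hyz]
    ext1 k
    simp only [hl, linForm, Fin.sum_univ_three, cons_val, Pi.add_apply, Pi.sub_apply, Pi.smul_apply,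
      smul_eq_mul]
    ring

end GeneralLine
end Regularity

/-! ### Homogenization -/

section Homogenization

variable {K : Type*} [Field K]

theorem isHomogeneousOfDegree_homogenize {d : ℕ} {f : MvPolynomial (Fin 2) K}
    (hf : f.totalDegree ≤ d) : IsHomogeneousOfDegree (homogenize d f) d := by
  refine .sum fun c hc => ?_
  have hcd : c 0 + c 1 ≤ d := by
    refine le_trans ?_ ((le_totalDegree hc).trans hf)
    rw [Finsupp.sum_fintype _ _ (fun _ => rfl), Fin.sum_univ_two]
  refine isHomogeneousOfDegree_natCast.2 (IsHomogeneous.C_mul ?_ _)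
  have := ((isHomogeneous_X_pow (R := K) (0 : Fin 3) (c 0)).mul
    (isHomogeneous_X_pow (1 : Fin 3) (c 1))).mul (isHomogeneous_X_pow (2 : Fin 3) (d - (c 0 + c 1)))
  rwa [Nat.add_sub_cancel' hcd] at this

/-- Setting `u = 1`. -/
noncomputable def dehomogenize : MvPolynomial (Fin 3) K →ₐ[K] MvPolynomial (Fin 2) K :=
  aeval ![X 0, X 1, 1]

theorem dehomogenize_homogenize (d : ℕ) (f : MvPolynomial (Fin 2) K) :
    dehomogenize (homogenize d f) = f := by
  conv_rhs => rw [f.as_sum]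
  rw [homogenize, map_sum]
  refine Finset.sum_congr rfl fun c _ => ?_
  rw [monomial_eq, Finsupp.prod_fintype _ _ (fun _ => pow_zero _), Fin.prod_univ_two]
  simp [dehomogenize]

theorem totalDegree_dehomogenize_le (f : MvPolynomial (Fin 3) K) :
    (dehomogenize f).totalDegree ≤ f.totalDegree := by
  conv_lhs => rw [f.as_sum]
  rw [map_sum]
  refine totalDegree_finsetSum_le fun c hc => ?_
  refine le_trans ?_ (le_totalDegree hc)
  rw [monomial_eq, Finsupp.prod_fintype _ _ (fun _ => pow_zero _), Fin.prod_univ_three,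
    Finsupp.sum_fintype _ _ (fun _ => rfl), Fin.sum_univ_three]
  simp only [dehomogenize, map_mul, map_pow, aeval_X, aeval_C, Matrix.cons_val, one_pow, mul_one,
    algebraMap_eq]
  refine (totalDegree_mul _ _).trans ?_
  rw [totalDegree_C, zero_add]
  refine (totalDegree_mul _ _).trans ?_
  rw [totalDegree_X_pow, totalDegree_X_pow]
  omega

/-- Homogenizations to the maximal degree of polynomials without common factor have no common
prime factor: such a factor becomes a unit on setting `u = 1`, and for the polynomial of degree `d`
this leaves no room for it. -/
theorem not_forall_prime_dvd_homogenize {ι : Type*} [Fintype ι] [Nonempty ι]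
    (P : ι → MvPolynomial (Fin 2) K)
    (hgcd : ∀ g : MvPolynomial (Fin 2) K, (∀ i, g ∣ P i) → IsUnit g)
    {d : ℕ} (hd : d = Finset.univ.sup fun i => (P i).totalDegree) (hd_pos : 1 ≤ d)
    (ρ : MvPolynomial (Fin 3) K) (hρ : Prime ρ) : ¬ ∀ i, ρ ∣ homogenize d (P i) := by
  intro hdvd
  obtain ⟨i, -, hi⟩ := Finset.exists_mem_eq_sup Finset.univ Finset.univ_nonempty
    fun i => (P i).totalDegree
  rw [← hd] at hi
  obtain ⟨u, hu⟩ := hgcd (dehomogenize ρ) fun j => by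
    have := map_dvd (dehomogenize (K := K)) (hdvd j)
    rwa [dehomogenize_homogenize] at this
  have hunit : (dehomogenize ρ).totalDegree = 0 :=
    (isUnit_iff_totalDegree_of_isReduced.1 ⟨u, hu⟩).2
  obtain ⟨e, he⟩ := hdvd i
  have hP : P i = dehomogenize ρ * dehomogenize e := by
    rw [← map_mul, ← he, dehomogenize_homogenize]
  have he0 : e ≠ 0 := by
    rintro rfl
    rw [map_zero, mul_zero] at hP
    rw [hP, totalDegree_zero] at hi
    omega
  have h1 : d ≤ e.totalDegree := by
    rw [hi, hP]
    refine (totalDegree_mul _ _).trans ?_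
    rw [hunit, zero_add]
    exact totalDegree_dehomogenize_le e
  have h2 : (homogenize d (P i)).totalDegree ≤ d :=
    (isHomogeneousOfDegree_natCast.1 (isHomogeneousOfDegree_homogenize hi.ge)).totalDegree_le
  rw [he, totalDegree_mul_of_isDomain hρ.ne_zero he0] at h2
  have h3 : ρ.totalDegree = 0 := by omega
  rw [totalDegree_eq_zero_iff_eq_C] at h3
  refine hρ.not_isUnit ?_
  rw [h3] at hρ ⊢
  exact (isUnit_iff_ne_zero.2 fun h => hρ.ne_zero (by rw [h, C_0])).map C

end Homogenization

/-! ### Minimal generators -/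

section MinimalGenerators

variable {σ K : Type*} [Field K] {ι κ : Type*} [Fintype κ]

open Matrix

/-- A homogeneous relation between minimal generators has no unit among its coefficients. -/
theorem constantCoeff_eq_zero_of_mulVec_eq_zero {D : Matrix ι κ (MvPolynomial σ K)}
    (hmin : ∀ i, D.col i ∉ Submodule.span (MvPolynomial σ K) (D.col '' {i}ᶜ))
    {y : κ → MvPolynomial σ K} (hy : D *ᵥ y = 0) {k : κ} {n : ℤ}
    (hk : IsHomogeneousOfDegree (y k) n) : constantCoeff (y k) = 0 := by
  classical
  by_contra h
  refine hmin k ?_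
  have h1 : D *ᵥ y = y k • D.col k + ∑ i ∈ Finset.univ.erase k, y i • D.col i := by
    rw [Finset.add_sum_erase _ (fun i => y i • D.col i) (Finset.mem_univ k)]
    ext j : 1
    simp [mulVec, dotProduct, mul_comm]
  rw [hy] at h1
  have h2 : D.col k = -(C (constantCoeff (y k))⁻¹ : MvPolynomial σ K) •
      ∑ i ∈ Finset.univ.erase k, y i • D.col i := by
    rw [← neg_eq_of_add_eq_zero_right h1.symm, smul_neg, neg_smul, neg_neg, smul_smul]
    conv_rhs => rw [hk.eq_C h]
    rw [constantCoeff_C, ← C_mul, inv_mul_cancel₀ h, C_1, one_smul]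
  rw [h2]
  refine Submodule.smul_mem _ _ (Submodule.sum_mem _ fun i hi => Submodule.smul_mem _ _ ?_)
  exact Submodule.subset_span ⟨i, (Finset.mem_erase.1 hi).1, rfl⟩

theorem gcomp_mulVec {D : Matrix ι κ (MvPolynomial σ K)} {r : ι → ℤ} {q : κ → ℤ}
    (hD : ∀ j k, IsHomogeneousOfDegree (D j k) (q k - r j)) (v : κ → MvPolynomial σ K) (e : ℤ)
    (j : ι) : gcomp (e - r j) ((D *ᵥ v) j) = (D *ᵥ fun k => gcomp (e - q k) (v k)) j := by
  simp only [mulVec, dotProduct, map_sum]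
  refine Finset.sum_congr rfl fun k _ => ?_
  rw [(hD j k).gcomp_mul]
  congr 2
  ring_nf

/-- Graded Nakayama lemma: a minimal generator is not a combination of the generators with
coefficients in the maximal ideal. -/
theorem col_ne_mulVec_of_constantCoeff_eq_zero {D : Matrix ι κ (MvPolynomial σ K)}
    {r : ι → ℤ} {q : κ → ℤ} (hD : ∀ j k, IsHomogeneousOfDegree (D j k) (q k - r j))
    (hmin : ∀ i, D.col i ∉ Submodule.span (MvPolynomial σ K) (D.col '' {i}ᶜ))
    (k : κ) {v : κ → MvPolynomial σ K} (hv : constantCoeff (v k) = 0) : D.col k ≠ D *ᵥ v := by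
  classical
  intro h
  -- In the component of degree `q k`, the coefficient of the generator itself is the constant
  -- term of `v k`.
  let v' : κ → MvPolynomial σ K := fun i => gcomp (q k - q i) (v i)
  have hv' : D *ᵥ v' = D.col k := by
    ext1 j
    rw [← gcomp_mulVec hD, ← h]
    exact (hD j k).gcomp_eq
  have hvk : v' k = 0 := by
    simp only [v', sub_self]
    ext c
    rw [coeff_gcomp, coeff_zero]
    split_ifs with h0
    · have : c = 0 := (Finsupp.degree_eq_zero_iff c).1 (by exact_mod_cast h0)
      rw [this]
      exact hv
    · rfl
  have h0 : D *ᵥ (v' - Pi.single k 1) = 0 := by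
    rw [mulVec_sub, hv', mulVec_single_one, sub_self]
  have := constantCoeff_eq_zero_of_mulVec_eq_zero hmin h0 (k := k) (n := 0) (by
    simpa [hvk] using (isHomogeneousOfDegree_C (σ := σ) (1 : K)).neg)
  simp [hvk] at this

end MinimalGenerators

/-! ### Degree bounds -/

section Bounds

variable {K : Type*} [Field K] {b : Fin 4 → MvPolynomial (Fin 3) K} {d : ℕ} {α β : K}
  {F G : MvPolynomial (Fin 3) K} {μ ν : Fin 4 → K} {a : ℕ} {p : Fin a → ℤ} {q : Fin (a + 3) → ℤ}
  {D₁ : Matrix (Fin 4) (Fin (a + 3)) (MvPolynomial (Fin 3) K)}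
  {D₂ : Matrix (Fin (a + 3)) (Fin a) (MvPolynomial (Fin 3) K)}

open Matrix

theorem IsResolution.sum_mul_eq_zero_iff (hres : IsResolution b d p q D₁ D₂)
    (c : Fin 4 → MvPolynomial (Fin 3) K) :
    ∑ i, c i * b i = 0 ↔ ∃ u, D₁ *ᵥ u = c := by
  have := hres.exact₀ c
  rw [Fintype.linearCombination_apply] at this
  simpa [Set.mem_range] using this

theorem IsResolution.constantCoeff_eq_zero (hres : IsResolution b d p q D₁ D₂) (i : Fin (a + 3))
    (k : Fin a) : constantCoeff (D₂ i k) = 0 := by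
  have h : D₁ *ᵥ D₂.col k = 0 := by
    have := (hres.exact₁ (D₂.col k)).2 ⟨Pi.single k 1, by simp⟩
    simpa using this
  exact constantCoeff_eq_zero_of_mulVec_eq_zero hres.minimal h (hres.homogeneous₂ i k)

theorem IsResolution.q_le (hres : IsResolution b d p q D₁ D₂)
    (hgl : GeneralLine b d α β F G μ ν) (k : Fin (a + 3)) : q k ≤ 3 * (d : ℤ) - 1 := by
  by_contra! hk
  obtain ⟨s, hs, hcs⟩ := hgl.exists_syzygy_eq_sum_X_mul (e := q k - d) (c := D₁.col k)
    (by omega) (fun i => hres.homogeneous₁ i k)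
    ((hres.sum_mul_eq_zero_iff _).2 ⟨Pi.single k 1, by simp⟩)
  choose u hu using fun j => (hres.sum_mul_eq_zero_iff (s j)).1 (hs j)
  refine col_ne_mulVec_of_constantCoeff_eq_zero (r := fun _ => (d : ℤ)) hres.homogeneous₁
    hres.minimal k (v := ∑ j, (X j : MvPolynomial (Fin 3) K) • u j) (by simp) ?_
  ext1 i
  rw [mulVec_sum, hcs i, Finset.sum_apply]
  exact Finset.sum_congr rfl fun j _ => by rw [mulVec_smul, hu]; rfl

theorem IsResolution.p_le (hres : IsResolution b d p q D₁ D₂)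
    (hgl : GeneralLine b d α β F G μ ν) (k : Fin a) : p k ≤ 3 * (d : ℤ) := by
  by_contra! hk
  have hker : ∀ y, D₁ *ᵥ y = 0 ↔ ∃ t, D₂ *ᵥ t = y := fun y => by
    simpa [Set.mem_range] using hres.exact₁ y
  obtain ⟨z, hz, hyz⟩ := hgl.exists_mem_ker_eq_sum_X_mul (q := q) (p := p k) hres.homogeneous₁
    hres.sum_mul_eq_zero_iff (by omega) (y := D₂.col k)
    (fun i => hres.homogeneous₂ i k) (fun i => hres.constantCoeff_eq_zero i k)
    ((hker _).2 ⟨Pi.single k 1, by simp⟩)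
  choose t ht using fun j => (hker (z j)).1 (hz j)
  have h1 : Pi.single k 1 = ∑ j, (X j : MvPolynomial (Fin 3) K) • t j := by
    apply hres.injective
    simp only [mulVecLin_apply, mulVec_single_one, mulVec_sum, mulVec_smul, ht]
    exact hyz
  have h2 := congrArg constantCoeff (congrFun h1 k)
  simp at h2

end Bounds
open Matrix

/-! ### Existence of minimal resolutions -/

section ExistenceOfMinimalResolutions

variable {σ K : Type*} [Field K]

/-- A graded submodule of a free module with basis in degrees `tw`: stability under taking
homogeneous components. -/
def IsGradedSubmodule {n : ℕ} (tw : Fin n → ℤ)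
    (N : Submodule (MvPolynomial σ K) (Fin n → MvPolynomial σ K)) : Prop :=
  ∀ v ∈ N, ∀ e : ℤ, (fun j => gcomp (e - tw j) (v j)) ∈ N

theorem isGradedSubmodule_ker {n m : ℕ} {tw : Fin n → ℤ} {tw' : Fin m → ℤ}
    {D : Matrix (Fin n) (Fin m) (MvPolynomial σ K)}
    (hD : ∀ j k, IsHomogeneousOfDegree (D j k) (tw' k - tw j)) :
    IsGradedSubmodule tw' (LinearMap.ker D.mulVecLin) := by
  intro v hv e
  rw [LinearMap.mem_ker, mulVecLin_apply] at hv ⊢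
  ext1 j
  rw [← gcomp_mulVec hD, hv]
  simp

theorem IsGradedSubmodule.span_homogeneous {n : ℕ} {tw : Fin n → ℤ}
    {N : Submodule (MvPolynomial σ K) (Fin n → MvPolynomial σ K)} (hN : IsGradedSubmodule tw N) :
    Submodule.span (MvPolynomial σ K)
      {v | v ∈ N ∧ ∃ e : ℤ, ∀ j, IsHomogeneousOfDegree (v j) (e - tw j)} = N := by
  classical
  refine le_antisymm (Submodule.span_le.2 fun v hv => hv.1) fun v hv => ?_
  let E : Finset ℤ := Finset.univ.biUnion fun j =>
    (v j).support.image fun c => ((c.degree : ℕ) : ℤ) + tw j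
  have hE : v = ∑ e ∈ E, fun j => gcomp (e - tw j) (v j) := by
    ext j c
    rw [Finset.sum_apply, coeff_sum]
    simp only [coeff_gcomp]
    by_cases hc : coeff c (v j) = 0
    · simp [hc]
    · rw [Finset.sum_eq_single (((c.degree : ℕ) : ℤ) + tw j)]
      · simp
      · intro e _ he
        rw [if_neg]
        intro h
        exact he (by rw [h]; ring)
      · intro h
        exact absurd (Finset.mem_biUnion.2 ⟨j, Finset.mem_univ _,
          Finset.mem_image.2 ⟨c, mem_support_iff.2 hc, rfl⟩⟩) h
  rw [hE]
  exact Submodule.sum_mem _ fun e _ => Submodule.subset_span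
    ⟨hN v hv e, e, fun j => isHomogeneousOfDegree_gcomp _ _⟩

/-- A graded submodule of a graded free module of finite rank has a minimal finite system of
homogeneous generators: take one with the fewest elements. -/
theorem IsGradedSubmodule.exists_minimal_generators [Finite σ] {n : ℕ} {tw : Fin n → ℤ}
    {N : Submodule (MvPolynomial σ K) (Fin n → MvPolynomial σ K)} (hN : IsGradedSubmodule tw N) :
    ∃ (m : ℕ) (tw' : Fin m → ℤ) (B : Matrix (Fin n) (Fin m) (MvPolynomial σ K)),
      (∀ j k, IsHomogeneousOfDegree (B j k) (tw' k - tw j)) ∧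
      Submodule.span (MvPolynomial σ K) (Set.range B.col) = N ∧
      ∀ i, B.col i ∉ Submodule.span (MvPolynomial σ K) (B.col '' {i}ᶜ) := by
  classical
  let A (m : ℕ) : Prop := ∃ (tw' : Fin m → ℤ) (B : Matrix (Fin n) (Fin m) (MvPolynomial σ K)),
      (∀ j k, IsHomogeneousOfDegree (B j k) (tw' k - tw j)) ∧
      Submodule.span (MvPolynomial σ K) (Set.range B.col) = N
  have hex : ∃ m, A m := by
    have hfg : N.FG := IsNoetherian.noetherian N
    rw [← hN.span_homogeneous, Submodule.fg_span_iff_fg_span_finset_subset] at hfg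
    obtain ⟨s, hs, hspan⟩ := hfg
    rw [hN.span_homogeneous] at hspan
    choose e he using fun v : s => (hs v.2).2
    let f := s.equivFin.symm
    refine ⟨s.card, fun k => e (f k), fun j k => (f k).1 j, fun j k => he (f k) j, ?_⟩
    rw [hspan]
    congr 1
    ext v
    constructor
    · rintro ⟨k, rfl⟩
      exact (f k).2
    · intro hv
      exact ⟨f.symm ⟨v, hv⟩, by
        change (f (f.symm _)).1 = v
        rw [Equiv.apply_symm_apply]⟩
  obtain ⟨tw', B, hB, hspan⟩ := Nat.find_spec hex
  have hmin := fun m => Nat.find_min hex (m := m)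
  generalize Nat.find hex = m at tw' B hmin
  refine ⟨m, tw', B, hB, hspan, fun i hi => ?_⟩
  cases m with
  | zero => exact i.elim0
  | succ m =>
    refine hmin m (Nat.lt_succ_self m) ⟨tw' ∘ i.succAbove, B.submatrix id i.succAbove,
      fun j k => hB j _, ?_⟩
    have h1 : Set.range (B.submatrix id i.succAbove).col = B.col '' {i}ᶜ := by
      rw [← Fin.range_succAbove, ← Set.range_comp]
      rfl
    rw [h1, ← hspan]
    refine le_antisymm (Submodule.span_mono (Set.image_subset_range _ _)) ?_
    rw [Submodule.span_le]
    rintro _ ⟨k, rfl⟩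
    by_cases hk : k = i
    · rw [hk]
      exact hi
    · exact Submodule.subset_span ⟨k, hk, rfl⟩

variable (σ K) in
/-- A graded submodule of the graded free module of rank `n` whose basis has the degrees `tw`. -/
structure GradedSubmodule where
  /-- the rank of the ambient module -/
  n : ℕ
  /-- the degrees of the basis of the ambient module -/
  tw : Fin n → ℤ
  /-- the submodule -/
  N : Submodule (MvPolynomial σ K) (Fin n → MvPolynomial σ K)
  graded : IsGradedSubmodule tw N

namespace GradedSubmodule

variable [Finite σ] (s : GradedSubmodule σ K)

/-- The module of relations between a chosen minimal system of homogeneous generators. -/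
noncomputable def syz : GradedSubmodule σ K where
  n := s.graded.exists_minimal_generators.choose
  tw := s.graded.exists_minimal_generators.choose_spec.choose
  N := LinearMap.ker s.graded.exists_minimal_generators.choose_spec.choose_spec.choose.mulVecLin
  graded := isGradedSubmodule_ker
    s.graded.exists_minimal_generators.choose_spec.choose_spec.choose_spec.1

/-- The matrix whose columns are the chosen minimal generators. -/
noncomputable def gens : Matrix (Fin s.n) (Fin s.syz.n) (MvPolynomial σ K) :=
  s.graded.exists_minimal_generators.choose_spec.choose_spec.choose

theorem gens_homogeneous (j : Fin s.n) (k : Fin s.syz.n) :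
    IsHomogeneousOfDegree (s.gens j k) (s.syz.tw k - s.tw j) :=
  s.graded.exists_minimal_generators.choose_spec.choose_spec.choose_spec.1 j k

theorem span_gens : Submodule.span (MvPolynomial σ K) (Set.range s.gens.col) = s.N :=
  s.graded.exists_minimal_generators.choose_spec.choose_spec.choose_spec.2.1

theorem gens_minimal (i : Fin s.syz.n) :
    s.gens.col i ∉ Submodule.span (MvPolynomial σ K) (s.gens.col '' {i}ᶜ) :=
  s.graded.exists_minimal_generators.choose_spec.choose_spec.choose_spec.2.2 i

theorem range_gens : LinearMap.range s.gens.mulVecLin = s.N := by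
  rw [range_mulVecLin, span_gens]

theorem syz_N : s.syz.N = LinearMap.ker s.gens.mulVecLin := rfl

theorem exact_gens : Function.Exact s.syz.gens.mulVecLin s.gens.mulVecLin := by
  rw [LinearMap.exact_iff, ← syz_N, range_gens]

theorem gens_syz_mem (j : Fin s.syz.n) (k : Fin s.syz.syz.n) :
    s.syz.gens j k ∈ Ideal.span (Set.range (X : σ → MvPolynomial σ K)) := by
  have h1 : s.gens *ᵥ s.syz.gens.col k = 0 := by
    have := (s.exact_gens (s.syz.gens.col k)).2 ⟨Pi.single k 1, by simp⟩
    simpa using this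
  have h2 := constantCoeff_eq_zero_of_mulVec_eq_zero s.gens_minimal h1
    (s.syz.gens_homogeneous j k)
  have := Fintype.ofFinite σ
  obtain ⟨g, hg⟩ := exists_eq_sum_X_mul h2
  change s.syz.gens j k = _ at hg
  rw [hg]
  exact Ideal.sum_mem _ fun i _ => Ideal.mul_mem_right _ _ (Ideal.subset_span ⟨i, rfl⟩)

/-- The iterated syzygy modules. -/
noncomputable def iterSyz : ℕ → GradedSubmodule σ K
  | 0 => s
  | i + 1 => (iterSyz i).syz

end GradedSubmodule

theorem mulVecLin_eq_const_iff {R : Type*} [CommRing R] {m : ℕ} (B : Matrix (Fin 1) (Fin m) R)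
    (v : Fin m → R) (f : R) :
    B.mulVecLin v = (fun _ => f) ↔ Fintype.linearCombination R (fun j => B 0 j) v = f := by
  rw [funext_iff, Fin.forall_fin_one]
  simp [Fintype.linearCombination_apply, mulVec, dotProduct, mul_comm]

/-- An ideal that contains the homogeneous components of its elements has a minimal graded free
resolution. -/
theorem nonempty_minimalGradedFreeResolution [Finite σ] (I : Ideal (MvPolynomial σ K))
    (hI : ∀ f ∈ I, ∀ e : ℤ, gcomp e f ∈ I) : Nonempty (MinimalGradedFreeResolution I) := by
  let s : GradedSubmodule σ K :=
    { n := 1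
      tw := 0
      N := Submodule.comap
        (LinearMap.proj (R := MvPolynomial σ K) (φ := fun _ : Fin 1 => MvPolynomial σ K) 0) I
      graded := fun v hv e => by simpa using hI (v 0) hv e }
  refine ⟨{
    rank := fun i => (s.iterSyz (i + 1)).n
    twist := fun i => (s.iterSyz (i + 1)).tw
    gen := fun j => s.gens 0 j
    diff := fun i => (s.iterSyz (i + 1)).gens
    gen_homogeneous := fun j => (s.gens_homogeneous 0 j).congr (by simp [s]; rfl)
    diff_homogeneous := fun i j k => (s.iterSyz (i + 1)).gens_homogeneous j k
    span_gen := ?_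
    exact_zero := ?_
    exact_succ := fun i => (s.iterSyz (i + 1)).exact_gens
    minimal := fun i j k => (s.iterSyz i).gens_syz_mem j k }⟩
  · have hr := s.range_gens
    ext f
    have h1 : (fun _ => f) ∈ s.N ↔ f ∈ I := Iff.rfl
    rw [← h1, ← hr, LinearMap.mem_range, Ideal.mem_span_range_iff_exists_fun]
    exact exists_congr fun c => (mulVecLin_eq_const_iff s.gens c f).symm
  · exact fun v => (mulVecLin_eq_const_iff s.gens v 0).symm.trans (s.exact_gens v)

end ExistenceOfMinimalResolutions

/-! ### Comparison of resolutions -/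

section Comparison

variable {R k : Type*} [CommRing R] [Field k]

theorem exists_mul_eq_of_exact {l m n o : Type*} [Fintype m] [Fintype n] [Fintype o]
    {D : Matrix m n R} {E : Matrix l m R} (h : Function.Exact D.mulVecLin E.mulVecLin)
    {M : Matrix m o R} (hM : E * M = 0) : ∃ N : Matrix n o R, D * N = M := by
  classical
  have h1 : ∀ k, ∃ v, D *ᵥ v = M.col k := fun k => by
    refine (h (M.col k)).1 ?_
    have := congrArg (fun A : Matrix l o R => A.col k) hM
    ext1 i
    exact congrFun this i
  choose v hv using h1
  refine ⟨Matrix.of fun i k => v k i, ?_⟩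
  ext i k
  exact congrFun (hv k) i

theorem mul_eq_zero_of_exact {l m n : Type*} [Fintype m] [Fintype n]
    {D : Matrix m n R} {E : Matrix l m R} (h : Function.Exact D.mulVecLin E.mulVecLin) :
    E * D = 0 := by
  classical
  ext i k
  have := (h (D.col k)).2 ⟨Pi.single k 1, by simp⟩
  exact congrFun this i

/-- Let `A` and `B` be free resolutions of the same module, generated by the entries of the rows
`A₀` and `B₀`. If the matrices `A₂`, `A₃` vanish modulo the kernel of `ε`, then the second module
of `A` has at most the rank of that of `B`: a chain map `A → B → A` that lifts the identity is
homotopic to the identity, so that it is the identity modulo the kernel of `ε` in degree two. -/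
theorem card_le_of_exact (ε : R →+* k) {o a₀ a₁ a₂ a₃ b₀ b₁ b₂ : Type*} [Fintype o]
    [Fintype a₀] [Fintype a₁] [Fintype a₂] [Fintype a₃] [Fintype b₀] [Fintype b₁] [Fintype b₂]
    {A₀ : Matrix o a₀ R} {A₁ : Matrix a₀ a₁ R} {A₂ : Matrix a₁ a₂ R} {A₃ : Matrix a₂ a₃ R}
    {B₀ : Matrix o b₀ R} {B₁ : Matrix b₀ b₁ R} {B₂ : Matrix b₁ b₂ R}
    (hA₁ : Function.Exact A₁.mulVecLin A₀.mulVecLin)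
    (hA₂ : Function.Exact A₂.mulVecLin A₁.mulVecLin)
    (hA₃ : Function.Exact A₃.mulVecLin A₂.mulVecLin)
    (hB₁ : Function.Exact B₁.mulVecLin B₀.mulVecLin)
    (hB₂ : Function.Exact B₂.mulVecLin B₁.mulVecLin)
    (hAB : ∃ φ : Matrix b₀ a₀ R, B₀ * φ = A₀) (hBA : ∃ ψ : Matrix a₀ b₀ R, A₀ * ψ = B₀)
    (hε₂ : A₂.map ε = 0) (hε₃ : A₃.map ε = 0) : Fintype.card a₂ ≤ Fintype.card b₂ := by
  classical
  obtain ⟨φ₀, hφ₀⟩ := hAB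
  obtain ⟨ψ₀, hψ₀⟩ := hBA
  have a10 := mul_eq_zero_of_exact hA₁
  have a21 := mul_eq_zero_of_exact hA₂
  have b10 := mul_eq_zero_of_exact hB₁
  have b21 := mul_eq_zero_of_exact hB₂
  obtain ⟨φ₁, hφ₁⟩ := exists_mul_eq_of_exact hB₁ (M := φ₀ * A₁) (by
    rw [← Matrix.mul_assoc, hφ₀, a10])
  obtain ⟨φ₂, hφ₂⟩ := exists_mul_eq_of_exact hB₂ (M := φ₁ * A₂) (by
    rw [← Matrix.mul_assoc, hφ₁, Matrix.mul_assoc, a21, Matrix.mul_zero])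
  obtain ⟨ψ₁, hψ₁⟩ := exists_mul_eq_of_exact hA₁ (M := ψ₀ * B₁) (by
    rw [← Matrix.mul_assoc, hψ₀, b10])
  obtain ⟨ψ₂, hψ₂⟩ := exists_mul_eq_of_exact hA₂ (M := ψ₁ * B₂) (by
    rw [← Matrix.mul_assoc, hψ₁, Matrix.mul_assoc, b21, Matrix.mul_zero])
  -- The homotopy.
  obtain ⟨h₀, hh₀⟩ := exists_mul_eq_of_exact hA₁ (M := ψ₀ * φ₀ - 1) (by
    rw [Matrix.mul_sub, ← Matrix.mul_assoc, hψ₀, hφ₀, Matrix.mul_one, sub_self])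
  obtain ⟨h₁, hh₁⟩ := exists_mul_eq_of_exact hA₂ (M := ψ₁ * φ₁ - 1 - h₀ * A₁) (by
    rw [Matrix.mul_sub, Matrix.mul_sub, ← Matrix.mul_assoc, ← Matrix.mul_assoc, hψ₁, hh₀,
      Matrix.mul_assoc, hφ₁, Matrix.sub_mul, Matrix.mul_assoc, Matrix.one_mul, Matrix.mul_one,
      sub_self])
  obtain ⟨h₂, hh₂⟩ := exists_mul_eq_of_exact hA₃ (M := ψ₂ * φ₂ - 1 - h₁ * A₂) (by
    rw [Matrix.mul_sub, Matrix.mul_sub, ← Matrix.mul_assoc, ← Matrix.mul_assoc, hψ₂, hh₁,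
      Matrix.mul_assoc, hφ₂, Matrix.sub_mul, Matrix.sub_mul, Matrix.mul_assoc, Matrix.mul_assoc h₀,
      a21, Matrix.one_mul, Matrix.mul_one, Matrix.mul_zero, sub_zero, sub_self])
  have hone : ψ₂.map ε * φ₂.map ε = 1 := by
    have h := congrArg (fun M : Matrix a₂ a₂ R => M.map ε) hh₂
    simp only [Matrix.map_mul, hε₃, Matrix.zero_mul] at h
    have h' : (ψ₂ * φ₂ - 1 - h₁ * A₂).map ε =
        ψ₂.map ε * φ₂.map ε - 1 - h₁.map ε * A₂.map ε := by
      rw [Matrix.map_sub _ (map_sub ε), Matrix.map_sub _ (map_sub ε), Matrix.map_mul,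
        Matrix.map_mul, Matrix.map_one _ (map_zero ε) (map_one ε)]
    rw [h', hε₂, Matrix.mul_zero, sub_zero] at h
    exact (sub_eq_zero.1 h.symm)
  have h1 := Matrix.rank_mul_le_right (ψ₂.map ε) (φ₂.map ε)
  rw [hone, Matrix.rank_one] at h1
  exact h1.trans (Matrix.rank_le_card_height _)

end Comparison

/-! ### Betti numbers -/

section Betti

variable {σ K : Type*} [Field K]

theorem exact_row_iff {ι κ : Type*} [Fintype ι] [Fintype κ] {R : Type*} [CommRing R]
    {D : Matrix ι κ R} {b : ι → R} :
    Function.Exact D.mulVecLin (Matrix.of fun (_ : Unit) i => b i).mulVecLin ↔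
      Function.Exact D.mulVecLin (Fintype.linearCombination R b) := by
  refine forall_congr' fun v => ?_
  rw [Fintype.linearCombination_apply, mulVecLin_apply, funext_iff]
  simp [mulVec, dotProduct, mul_comm]

theorem exists_row_mul_eq_of_span_le {ι κ : Type*} [Fintype ι] {R : Type*} [CommRing R]
    {b : ι → R} {g : κ → R} (h : Ideal.span (Set.range g) ≤ Ideal.span (Set.range b)) :
    ∃ φ : Matrix ι κ R, (Matrix.of fun (_ : Unit) i => b i) * φ = Matrix.of fun _ j => g j := by
  choose c hc using fun j => Ideal.mem_span_range_iff_exists_fun.1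
    (h (Ideal.subset_span (Set.mem_range_self j)))
  refine ⟨Matrix.of fun i j => c j i, ?_⟩
  ext u j
  simp [mul_apply, ← hc, mul_comm]

theorem MinimalGradedFreeResolution.map_diff {I : Ideal (MvPolynomial σ K)}
    (F : MinimalGradedFreeResolution I) (i : ℕ) :
    (F.diff i).map (constantCoeff : MvPolynomial σ K →+* K) = 0 := by
  ext j k
  exact constantCoeff_of_mem_span_X (F.minimal i j k)

/-- The second module of a minimal resolution has the rank `a`. The comparison applies in both
directions: it needs no minimality of the first map, and beyond `D₂` the given resolution is
continued by the zero module. -/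
theorem IsResolution.rank_eq {b : Fin 4 → MvPolynomial (Fin 3) K} {d a : ℕ} {p : Fin a → ℤ}
    {q : Fin (a + 3) → ℤ}
    {D₁ : Matrix (Fin 4) (Fin (a + 3)) (MvPolynomial (Fin 3) K)}
    {D₂ : Matrix (Fin (a + 3)) (Fin a) (MvPolynomial (Fin 3) K)}
    (hres : IsResolution b d p q D₁ D₂)
    (F : MinimalGradedFreeResolution (Ideal.span (Set.range b))) : F.rank 2 = a := by
  have hF₁ := exact_row_iff.2 F.exact_zero
  have hb₁ := exact_row_iff.2 hres.exact₀
  have hFb := exists_row_mul_eq_of_span_le F.span_gen.le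
  have hbF := exists_row_mul_eq_of_span_le F.span_gen.ge
  have hD₂ : D₂.map (constantCoeff : MvPolynomial (Fin 3) K →+* K) = 0 := by
    ext i k
    exact hres.constantCoeff_eq_zero i k
  have hb₃ : Function.Exact (0 : Matrix (Fin a) Empty (MvPolynomial (Fin 3) K)).mulVecLin
      D₂.mulVecLin := by
    intro v
    rw [Matrix.mulVecLin_zero, ← map_zero D₂.mulVecLin, hres.injective.eq_iff]
    simp [eq_comm]
  apply le_antisymm
  · simpa using card_le_of_exact constantCoeff hF₁ (F.exact_succ 0) (F.exact_succ 1) hb₁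
      hres.exact₁ hFb hbF (F.map_diff 1) (F.map_diff 2)
  · simpa using card_le_of_exact constantCoeff hb₁ hres.exact₁ hb₃ hF₁ (F.exact_succ 0) hbF hFb
      hD₂ (by ext _ k; exact k.elim)

theorem gcomp_mem_span_range {ι : Type*} [Fintype ι] {b : ι → MvPolynomial σ K} {d : ℤ}
    (hb : ∀ i, IsHomogeneousOfDegree (b i) d) {f : MvPolynomial σ K}
    (hf : f ∈ Ideal.span (Set.range b)) (e : ℤ) : gcomp e f ∈ Ideal.span (Set.range b) := by
  obtain ⟨c, rfl⟩ := Ideal.mem_span_range_iff_exists_fun.1 hf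
  rw [map_sum]
  refine Ideal.sum_mem _ fun i _ => ?_
  rw [mul_comm, (hb i).gcomp_mul]
  exact Ideal.mul_mem_right _ _ (Ideal.subset_span ⟨i, rfl⟩)

theorem IsResolution.eq_bettiNumber {b : Fin 4 → MvPolynomial (Fin 3) K} {d a : ℕ} {p : Fin a → ℤ}
    {q : Fin (a + 3) → ℤ}
    {D₁ : Matrix (Fin 4) (Fin (a + 3)) (MvPolynomial (Fin 3) K)}
    {D₂ : Matrix (Fin (a + 3)) (Fin a) (MvPolynomial (Fin 3) K)}
    (hres : IsResolution b d p q D₁ D₂) (hb : ∀ i, IsHomogeneousOfDegree (b i) d) :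
    a = bettiNumber (Ideal.span (Set.range b)) 2 := by
  obtain ⟨F₀⟩ := nonempty_minimalGradedFreeResolution (Ideal.span (Set.range b))
    fun f hf e => gcomp_mem_span_range hb hf e
  have : {n | ∃ F : MinimalGradedFreeResolution (Ideal.span (Set.range b)), F.rank 2 = n} =
      {a} := by
    ext n
    constructor
    · rintro ⟨F, rfl⟩
      exact hres.rank_eq F
    · rintro rfl
      exact ⟨F₀, hres.rank_eq F₀⟩
  rw [bettiNumber, this, csInf_singleton]

end Betti
end GradedRes

theorem mainTheorem9 {K : Type*} [Field K] [Infinite K]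
    (P : Fin 4 → MvPolynomial (Fin 2) K)
    (hgcd : ∀ g : MvPolynomial (Fin 2) K, (∀ i, g ∣ P i) → IsUnit g)
    (d : ℕ) (hd : d = Finset.univ.sup fun i => (P i).totalDegree) (hd_pos : 1 ≤ d)
    (a : ℕ) (p : Fin a → ℤ) (q : Fin (a + 3) → ℤ)
    (D₁ : Matrix (Fin 4) (Fin (a + 3)) (MvPolynomial (Fin 3) K))
    (D₂ : Matrix (Fin (a + 3)) (Fin a) (MvPolynomial (Fin 3) K))
    (hres : GradedRes.IsResolution (fun i => GradedRes.homogenize d (P i)) d p q D₁ D₂) :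
    (∀ i, q i ≤ 3 * (d : ℤ) - 1) ∧
    (∀ i, p i ≤ 3 * (d : ℤ)) ∧
    a = GradedRes.bettiNumber
      (Ideal.span (Set.range fun i => GradedRes.homogenize d (P i))) 2 := by
  have hhom : ∀ i, GradedRes.IsHomogeneousOfDegree (GradedRes.homogenize d (P i)) d := fun i =>
    GradedRes.isHomogeneousOfDegree_homogenize
      (hd ▸ Finset.le_sup (f := fun i => (P i).totalDegree) (Finset.mem_univ i))
  obtain ⟨α, β, hαβ⟩ := GradedRes.exists_slice_no_common_prime
    (fun i => GradedRes.homogenize d (P i))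
    (GradedRes.not_forall_prime_dvd_homogenize P hgcd hd hd_pos)
  obtain ⟨μ, ν, hμν⟩ := GradedRes.exists_isRelPrime_linear_combination
    (fun i => GradedRes.slice α β (GradedRes.homogenize d (P i)))
    (by
      by_contra! h
      exact hαβ (MvPolynomial.X 0) MvPolynomial.X_prime fun i => by rw [h i]; exact dvd_zero _)
    hαβ
  have hgl : GradedRes.GeneralLine (fun i => GradedRes.homogenize d (P i)) d α β _ _ μ ν :=
    { one_le := hd_pos
      homogeneous := hhom
      left_eq := rfl
      right_eq := rfl
      isRelPrime := by simpa using hμν }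
  exact ⟨hres.q_le hgl, hres.p_le hgl, hres.eq_bettiNumber hhom⟩
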